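/- An Orlicz function is a continuous, strictly increasing (not necessarily convex) function $\phi:[0,\infty)\to[0,\infty)$ with $\phi(0)=0$ and $\lim_{u\to\infty}\phi(u)=\infty$. Let $(\Omega,\Sigma,\mu)$ be one of the following: (A) a $\sigma$-finite non-atomic measure space with $\mu(\Omega)=\infty$; (B) a non-atomic measure space with $0<\mu(\Omega)<\infty$; (C) $\mathbb N$ with the counting measure. Put $I_\phi(f)=\int_\Omega\phi(|f|)\,d\mu$. The Orlicz space $L_\phi$ consists of all (classes of) measurable $f:\Omega\to\mathbb R$ with $I_\phi(\lambda f)<\infty$ for some $\lambda>0$, and carries the functional $\|f\|=\inf\{\varepsilon>0: I_\phi(f/\varepsilon)\le 1\}$. For $p\in\mathbb R$ write $\phi\in\Delta^{*p}$ if there is $K>0$ (in case (B): there are $K>0$, $v\ge 0$; in case (C): there are $K>0$, $v>0$) such that $\phi(au)\ge K a^p\phi(u)$ for all $a\ge 1$ and all $u\ge 0$ (in case (B): all $u\ge v$; in case (C): all $u\ge0$ with $au\le v$). Write $\phi\in\Delta_2$ if there is $K>0$ (in case (B): there are $K>0$, $v\ge 0$; in case (C): there are $K>0$, $v>0$) such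 that $\phi(2u)\le K\phi(u)$ for all $u\ge 0$ (in case (B): all $u\ge v$; in case (C): all $0\le u\le v$). Let $\alpha_\phi=\sup\{p\in\mathbb R:\phi\in\Delta^{*p}\}\in[-\infty,\infty]$ be the lower Matuszewska--Orlicz index. For $0<p\le 2$, the space $L_\phi$ is said to have (Rademacher) type $p$ if there is $K>0$ such that for all $n$ and all $f_1,\dots,f_n\in L_\phi$ $$\int_0^1\Big\|\sum_{k=1}^n r_k(t)f_k\Big\|\,dt\le K\Big(\sum_{k=1}^n\|f_k\|^p\Big)^{1/p},\qquad r_k(t)=\operatorname{sign}\sin(2^k\pi t).$$ Theorem. In each of the cases (A), (B), (C), let $\phi$ be an Orlicz function with $\alpha_\phi>0$. If $1<p\le 2$, then $L_\phi$ has type $p$ if and only if $\phi\in\Delta_2$ and $\phi\in\Delta^{*p}$. Moreover, for every $0<p\le 2$, if $\phi\in\Delta_2$ and $\phi\in\Delta^{*p}$, then $L_\phi$ has type $p$. -/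

import Mathlib

open MeasureTheory Filter
open scoped NNReal ENNReal

/-- An Orlicz function: a strictly increasing continuous `φ : ℝ₊ → ℝ₊` with `φ 0 = 0` and
`φ u → ∞` as `u → ∞`. Convexity is not required. -/
structure OrliczFunction where
  toFun : ℝ≥0 → ℝ≥0
  map_zero : toFun 0 = 0
  strictMono : StrictMono toFun
  continuous : Continuous toFun
  tendsto_atTop : Tendsto toFun atTop atTop

instance : CoeFun OrliczFunction (fun _ => ℝ≥0 → ℝ≥0) := ⟨OrliczFunction.toFun⟩

/-- The range of arguments for which a growth condition is imposed. -/
inductive ArgRange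
  /-- all arguments -/
  | all
  /-- large arguments -/
  | large
  /-- small arguments -/
  | small

namespace OrliczFunction

/-- Condition `Δ₂` for all, large or small arguments. -/
def DeltaTwo (φ : OrliczFunction) : ArgRange → Prop
  | .all => ∃ K : ℝ≥0, 0 < K ∧ ∀ u : ℝ≥0, φ (2 * u) ≤ K * φ u
  | .large => ∃ K : ℝ≥0, 0 < K ∧ ∃ v : ℝ≥0, ∀ u : ℝ≥0, v ≤ u → φ (2 * u) ≤ K * φ u
  | .small => ∃ K : ℝ≥0, 0 < K ∧ ∃ v : ℝ≥0, 0 < v ∧ ∀ u : ℝ≥0, u ≤ v → φ (2 * u) ≤ K * φ u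

/-- Condition `Δ^{*p}` for all, large or small arguments: `φ (a u) ≥ K a ^ p φ u` for `a ≥ 1`.
The inequality makes sense for every real exponent `p`. -/
def DeltaStar (φ : OrliczFunction) (p : ℝ) : ArgRange → Prop
  | .all => ∃ K : ℝ≥0, 0 < K ∧ ∀ a u : ℝ≥0, 1 ≤ a → K * a ^ p * φ u ≤ φ (a * u)
  | .large => ∃ K : ℝ≥0, 0 < K ∧ ∃ v : ℝ≥0, ∀ a u : ℝ≥0, 1 ≤ a → v ≤ u →
      K * a ^ p * φ u ≤ φ (a * u)
  | .small => ∃ K : ℝ≥0, 0 < K ∧ ∃ v : ℝ≥0, 0 < v ∧ ∀ a u : ℝ≥0, 1 ≤ a → a * u ≤ v →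
      K * a ^ p * φ u ≤ φ (a * u)

/-- The lower Matuszewska-Orlicz index `α_φ`, the supremum in `[-∞, ∞]` of all real `p` for which
`φ (a u) ≥ c a ^ p φ u` holds with some `c > 0` for `a ≥ 1` and all, large or small arguments. -/
noncomputable def lowerIndex (φ : OrliczFunction) (r : ArgRange) : EReal :=
  sSup {x : EReal | ∃ p : ℝ, φ.DeltaStar p r ∧ x = (p : EReal)}

variable {Ω : Type*} [MeasurableSpace Ω]

/-- The modular `I_φ(f) = ∫ φ(|f|) dμ ∈ [0, ∞]`. -/
noncomputable def modular (φ : OrliczFunction) {μ : Measure Ω} (f : Ω →ₘ[μ] ℝ) : ℝ≥0∞ :=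
  ∫⁻ t, (φ ‖f t‖₊ : ℝ≥0∞) ∂μ

theorem modular_zero (φ : OrliczFunction) {μ : Measure Ω} :
    φ.modular (0 : Ω →ₘ[μ] ℝ) = 0 := by
  have h : ∀ᵐ t ∂μ, (φ ‖(0 : Ω →ₘ[μ] ℝ) t‖₊ : ℝ≥0∞) = 0 := by
    filter_upwards [AEEqFun.coeFn_zero (μ := μ) (α := Ω) (β := ℝ)] with t ht
    rw [ht]
    simp [φ.map_zero]
  unfold modular
  rw [lintegral_congr_ae h, lintegral_zero]

theorem modular_mono (φ : OrliczFunction) {μ : Measure Ω} {f g : Ω →ₘ[μ] ℝ}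
    (h : ∀ᵐ t ∂μ, ‖f t‖₊ ≤ ‖g t‖₊) : φ.modular f ≤ φ.modular g := by
  refine lintegral_mono_ae ?_
  filter_upwards [h] with t ht
  exact_mod_cast φ.strictMono.monotone ht

theorem modular_half_add_le (φ : OrliczFunction) {μ : Measure Ω} (f g : Ω →ₘ[μ] ℝ) :
    φ.modular ((1 / 2 : ℝ) • (f + g)) ≤ φ.modular f + φ.modular g := by
  have hm : AEMeasurable (fun t => (φ ‖f t‖₊ : ℝ≥0∞)) μ :=
    ((φ.continuous.measurable.comp measurable_nnnorm).comp_aemeasurable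
      f.aestronglyMeasurable.aemeasurable).coe_nnreal_ennreal
  unfold modular
  rw [← lintegral_add_left' hm]
  refine lintegral_mono_ae ?_
  filter_upwards [AEEqFun.coeFn_smul (1 / 2 : ℝ) (f + g), AEEqFun.coeFn_add f g] with t h1 h2
  have h3 : ‖((1 / 2 : ℝ) • (f + g)) t‖₊ ≤ max ‖f t‖₊ ‖g t‖₊ := by
    rw [h1, Pi.smul_apply, h2, Pi.add_apply, ← NNReal.coe_le_coe, NNReal.coe_max]
    have h4 := norm_add_le (f t) (g t)
    have h5 := le_max_left ‖f t‖ ‖g t‖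
    have h6 := le_max_right ‖f t‖ ‖g t‖
    have h8 : ‖(1 / 2 : ℝ)‖ = 1 / 2 := by norm_num
    simp only [coe_nnnorm, norm_smul]
    rw [h8]
    linarith
  have h7 := φ.strictMono.monotone h3
  rw [φ.strictMono.monotone.map_max] at h7
  exact_mod_cast h7.trans (max_le_add_of_nonneg zero_le zero_le)

/-- The Orlicz space `L_φ(μ)`: all (classes of) measurable real functions `f` with
`I_φ(l f) < ∞` for some `l > 0`. -/
noncomputable def orliczSpace (φ : OrliczFunction) (μ : Measure Ω) :
    Submodule ℝ (Ω →ₘ[μ] ℝ) where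
  carrier := {f | ∃ l : ℝ, 0 < l ∧ φ.modular (l • f) < ∞}
  zero_mem' := ⟨1, one_pos, by rw [smul_zero, modular_zero]; simp⟩
  add_mem' := by
    rintro f g ⟨l, hl, hf⟩ ⟨m, hm, hg⟩
    refine ⟨1 / 2 * min l m, by positivity, ?_⟩
    have key : ∀ (h : Ω →ₘ[μ] ℝ) (c : ℝ), min l m ≤ c → φ.modular (c • h) < ∞ →
        φ.modular (min l m • h) < ∞ := by
      intro h c hc hfin
      refine lt_of_le_of_lt (modular_mono φ ?_) hfin
      filter_upwards [AEEqFun.coeFn_smul (min l m) h, AEEqFun.coeFn_smul c h] with t h1 h2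
      rw [h1, h2, Pi.smul_apply, Pi.smul_apply, nnnorm_smul, nnnorm_smul]
      refine mul_le_mul_left ?_ _
      rw [← NNReal.coe_le_coe, coe_nnnorm, coe_nnnorm, Real.norm_eq_abs, Real.norm_eq_abs,
        abs_of_pos (lt_min hl hm), abs_of_pos (lt_of_lt_of_le (lt_min hl hm) hc)]
      exact hc
    rw [mul_smul, smul_add]
    exact lt_of_le_of_lt (modular_half_add_le φ _ _)
      (ENNReal.add_lt_top.2 ⟨key f l (min_le_left _ _) hf, key g m (min_le_right _ _) hg⟩)
  smul_mem' := by
    rintro c f ⟨l, hl, hf⟩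
    by_cases hc : c = 0
    · exact ⟨1, one_pos, by rw [hc, zero_smul, smul_zero, modular_zero]; simp⟩
    · refine ⟨l / |c|, div_pos hl (abs_pos.2 hc), lt_of_le_of_lt (modular_mono φ ?_) hf⟩
      rw [smul_smul]
      filter_upwards [AEEqFun.coeFn_smul (l / |c| * c) f, AEEqFun.coeFn_smul l f] with t h1 h2
      rw [h1, h2, Pi.smul_apply, Pi.smul_apply, nnnorm_smul, nnnorm_smul]
      refine mul_le_mul_left (le_of_eq ?_) _
      ext
      have : |c| ≠ 0 := abs_ne_zero.2 hc
      simp only [coe_nnnorm, Real.norm_eq_abs, abs_mul, abs_div, abs_abs]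
      field_simp

/-- The Minkowski functional `‖f‖_φ = inf {ε > 0 : I_φ(f / ε) ≤ 1}` on `L_φ(μ)`. -/
noncomputable def quasiNorm (φ : OrliczFunction) {μ : Measure Ω} (f : φ.orliczSpace μ) : ℝ :=
  sInf {ε : ℝ | 0 < ε ∧ φ.modular (ε⁻¹ • (f : Ω →ₘ[μ] ℝ)) ≤ 1}

end OrliczFunction

/-- The Rademacher functions `r_n(t) = sign (sin (2 ^ n π t))`. -/
noncomputable def rademacher (n : ℕ) (t : ℝ) : ℝ :=
  Real.sign (Real.sin (2 ^ n * Real.pi * t))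

/-- A real vector space with quasi-norm `N` has (Rademacher) type `p`, `0 < p ≤ 2`: for some
`K > 0` and all finite families `x₁, …, xₙ`,
`∫₀¹ N (∑ₖ rₖ(t) xₖ) dt ≤ K (∑ₖ N(xₖ) ^ p) ^ (1 / p)`.
The integrand takes finitely many values, each on a finite union of intervals. -/
def HasRademacherType {X : Type*} [AddCommGroup X] [Module ℝ X] (N : X → ℝ) (p : ℝ) : Prop :=
  ∃ K : ℝ, 0 < K ∧ ∀ (n : ℕ) (x : Fin n → X),
    ∫ t in (0 : ℝ)..1, N (∑ k : Fin n, rademacher (k + 1) t • x k)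
      ≤ K * (∑ k : Fin n, N (x k) ^ p) ^ (1 / p)

/-- A non-atomic measure: every measurable set of positive measure contains a measurable set of
strictly smaller positive measure. (For singletons alone this would be weaker.) -/
def IsNonatomic {Ω : Type*} [MeasurableSpace Ω] (μ : Measure Ω) : Prop :=
  ∀ A : Set Ω, MeasurableSet A → 0 < μ A →
    ∃ B : Set Ω, MeasurableSet B ∧ B ⊆ A ∧ 0 < μ B ∧ μ B < μ A

/-! The Rademacher integral is an average over sign vectors, so type `p` compares the average
quasi-norm of the signed sums with the `ℓ^p` sum of the quasi-norms.

Sufficiency: `Δ^{*p}` makes `u ↦ φ (u ^ (1/p))` convex up to a constant, which yields a weak Jensen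
inequality (`mul_le_sum_of_growth`), while `Δ₂` yields Khintchine's inequality for `φ` itself
(`khintchine_of_doubling`). Applied pointwise and integrated, they bound the average over signs of
the modulars of the signed sums. The growth of `φ` turns a bound on a modular into a bound on a
quasi-norm; this is linear in the modular when `1 ≤ p`, so it can be averaged. For `p ≤ 1` no
averaging is needed, because the `ℓ^p` norm dominates every signed sum. When the conditions hold
only for large or small arguments, `φ` is replaced by a power function on the uncontrolled range
(`powBelow`, `powAbove`), which changes the modular unit ball only up to a scaling.

Necessity: type is tested on step functions over disjoint sets of equal measure. Disjointly
supported blocks `u 1_A` have signed sums of constant modulus, and type forces `Δ^{*p}`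
(`TypeBound.growth_of_hasDisjointFamily`). If `Δ₂` failed, the span of the indicators of `2 ^ n`
sets would resemble `ℓ_∞`; the sign patterns on these sets then behave like the basis of `ℓ_1^n`,
against type `p > 1` (`TypeBound.doubling_of_hasDisjointFamily`). The sets come from Sierpiński's
theorem, or are blocks of integers for the counting measure. -/

/-! ### Rademacher integrals as averages over signs. -/

/-- The real sign attached to a boolean. -/
def boolSign (b : Bool) : ℝ := if b then 1 else -1

theorem nnnorm_boolSign (b : Bool) : ‖boolSign b‖₊ = 1 := by
  cases b <;> simp [boolSign]

theorem sum_fin_succ_arrow_bool {M : Type*} [AddCommMonoid M] (n : ℕ)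
    (G : (Fin (n + 1) → Bool) → M) :
    ∑ s, G s = ∑ s : Fin n → Bool, G (Fin.cons true s) + ∑ s : Fin n → Bool, G (Fin.cons false s) := by
  rw [← (Fin.consEquiv (fun _ : Fin (n + 1) => Bool)).sum_comp, Fintype.sum_prod_type,
    Fintype.sum_bool]
  rfl

theorem rademacher_one_left {t : ℝ} (ht : t ∈ Set.Ioo (0 : ℝ) (1 / 2)) : rademacher 1 t = 1 := by
  apply Real.sign_of_pos
  have := Real.pi_pos
  have h1 := ht.1
  have h2 := ht.2
  apply Real.sin_pos_of_pos_of_lt_pi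
  · positivity
  · nlinarith

theorem rademacher_one_right {t : ℝ} (ht : t ∈ Set.Ioo (1 / 2 : ℝ) 1) : rademacher 1 t = -1 := by
  apply Real.sign_of_neg
  have := Real.pi_pos
  have h1 := ht.1
  have h2 := ht.2
  rw [show (2 : ℝ) ^ 1 * Real.pi * t = (2 * Real.pi * t - 2 * Real.pi) + 2 * Real.pi by ring,
    Real.sin_add_two_pi]
  apply Real.sin_neg_of_neg_of_neg_pi_lt <;> nlinarith

theorem rademacher_succ (k : ℕ) (t : ℝ) : rademacher (k + 1) t = rademacher k (2 * t) := by
  unfold rademacher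
  congr 2
  ring

theorem rademacher_sub_one (k : ℕ) (t : ℝ) : rademacher (k + 1) (t - 1) = rademacher (k + 1) t := by
  unfold rademacher
  congr 1
  rw [show (2 : ℝ) ^ (k + 1) * Real.pi * (t - 1) =
    2 ^ (k + 1) * Real.pi * t - ((2 ^ k : ℕ) : ℝ) * (2 * Real.pi) by push_cast; ring]
  exact Real.sin_sub_nat_mul_two_pi _ _

/-- Induction by self-similarity: on each half of `[0, 1]` the first Rademacher function is
constant, and the others are a rescaled copy of the shorter system. The halves are compared on open
intervals, since the Rademacher functions vanish at `0`, `1/2` and `1`. Integrability is carried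
along so that the integral can be split. -/
theorem hasIntegral_rademacher (n : ℕ) : ∀ F : (Fin n → ℝ) → ℝ,
    IntervalIntegrable (fun t => F (fun k => rademacher (k + 1) t)) volume 0 1 ∧
    ∫ t in (0 : ℝ)..1, F (fun k => rademacher (k + 1) t) =
      (1 / 2 ^ n) * ∑ s : Fin n → Bool, F (fun k => boolSign (s k)) := by
  induction n with
  | zero =>
    intro F
    have h : ∀ x : Fin 0 → ℝ, F x = F 0 := fun x => by rw [Subsingleton.elim x 0]
    simp [h]
  | succ n ih =>
    intro F
    obtain ⟨i1, e1⟩ := ih (fun x => F (Fin.cons 1 x))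
    obtain ⟨i2, e2⟩ := ih (fun x => F (Fin.cons (-1) x))
    set G := fun t => F (fun k : Fin (n + 1) => rademacher (k + 1) t) with hG
    have hl : Set.EqOn (fun t => F (Fin.cons 1 (fun k : Fin n => rademacher (k + 1) (2 * t)))) G
        (Set.Ioo 0 (1 / 2)) := by
      intro t ht
      simp only [hG]
      congr 1
      ext k
      refine Fin.cases ?_ (fun j => ?_) k
      · simp [rademacher_one_left ht]
      · simp [← rademacher_succ]
    have hr : Set.EqOn (fun t => F (Fin.cons (-1) (fun k : Fin n => rademacher (k + 1) (2 * t - 1))))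
        G (Set.Ioo (1 / 2) 1) := by
      intro t ht
      simp only [hG]
      congr 1
      ext k
      refine Fin.cases ?_ (fun j => ?_) k
      · simp [rademacher_one_right ht]
      · simp [rademacher_sub_one, ← rademacher_succ]
    have j1 : IntervalIntegrable
        (fun t => F (Fin.cons 1 (fun k : Fin n => rademacher (k + 1) (2 * t)))) volume 0 (1 / 2) := by
      simpa using i1.comp_mul_left (c := 2)
    have j2 : IntervalIntegrable
        (fun t => F (Fin.cons (-1) (fun k : Fin n => rademacher (k + 1) (2 * t - 1))))
          volume (1 / 2) 1 := by
      have := (i2.comp_sub_right 1).comp_mul_left (c := 2)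
      norm_num at this
      exact this
    have hl' := (intervalIntegrable_congr_uIoo (μ := volume) (a := 0) (b := 1 / 2)
      (by rwa [Set.uIoo_of_le (by norm_num)])).1 j1
    have hr' := (intervalIntegrable_congr_uIoo (μ := volume) (a := 1 / 2) (b := 1)
      (by rwa [Set.uIoo_of_le (by norm_num)])).1 j2
    refine ⟨hl'.trans hr', ?_⟩
    rw [← intervalIntegral.integral_add_adjacent_intervals hl' hr',
      ← intervalIntegral.integral_congr_uIoo (a := 0) (b := 1 / 2)
        (by rwa [Set.uIoo_of_le (by norm_num)]),
      ← intervalIntegral.integral_congr_uIoo (a := 1 / 2) (b := 1)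
        (by rwa [Set.uIoo_of_le (by norm_num)]),
      intervalIntegral.integral_comp_mul_left
        (fun t => F (Fin.cons 1 (fun k : Fin n => rademacher (k + 1) t))) two_ne_zero,
      intervalIntegral.integral_comp_mul_sub
        (fun t => F (Fin.cons (-1) (fun k : Fin n => rademacher (k + 1) t))) two_ne_zero]
    norm_num
    norm_num at e1 e2
    rw [e1, e2, sum_fin_succ_arrow_bool]
    have hc : ∀ (b : Bool) (s : Fin n → Bool),
        (fun k => boolSign ((Fin.cons b s : Fin (n + 1) → Bool) k)) =
          (Fin.cons (boolSign b) (fun k => boolSign (s k)) : Fin (n + 1) → ℝ) := by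
      intro b s
      ext k
      refine Fin.cases ?_ (fun j => ?_) k <;> simp
    simp only [hc]
    simp [boolSign]
    ring

/-! ### Scalar inequalities: weak Jensen and Khintchine. -/

theorem NNReal.sum_rpow_le_rpow_sum {ι : Type*} (s : Finset ι) (y : ι → ℝ≥0) {r : ℝ} (hr : 1 ≤ r) :
    ∑ i ∈ s, y i ^ r ≤ (∑ i ∈ s, y i) ^ r := by
  classical
  induction s using Finset.induction_on with
  | empty => simp [NNReal.zero_rpow (by linarith : r ≠ 0)]
  | insert i s hi ih =>
    rw [Finset.sum_insert hi, Finset.sum_insert hi]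
    exact (add_le_add le_rfl ih).trans (NNReal.add_rpow_le_rpow_add _ _ hr)

theorem NNReal.rpow_sum_rpow_le_of_le {ι : Type*} (s : Finset ι) (y : ι → ℝ≥0) {p q : ℝ}
    (hp : 0 < p) (hpq : p ≤ q) :
    (∑ i ∈ s, y i ^ q) ^ (1 / q) ≤ (∑ i ∈ s, y i ^ p) ^ (1 / p) := by
  have hq := hp.trans_le hpq
  have h := NNReal.sum_rpow_le_rpow_sum s (fun i => y i ^ p) (r := q / p) ((one_le_div hp).2 hpq)
  have e : ∀ i, (y i ^ p) ^ (q / p) = y i ^ q := fun i => by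
    rw [← NNReal.rpow_mul]; congr 1; field_simp
  simp only [e] at h
  refine (NNReal.rpow_le_rpow h (by positivity : (0 : ℝ) ≤ 1 / q)).trans (le_of_eq ?_)
  rw [← NNReal.rpow_mul]
  congr 1
  field_simp

/-- A weak form of Jensen's inequality for `u ↦ ψ (u ^ (1 / p))`. -/
theorem mul_le_sum_of_growth {ψ : ℝ≥0 → ℝ≥0} {K : ℝ≥0} {p : ℝ} (hp : 0 < p) (h0 : ψ 0 = 0)
    (hs : ∀ a u : ℝ≥0, 1 ≤ a → K * a ^ p * ψ u ≤ ψ (a * u)) {ι : Type*} [Fintype ι]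
    (w x : ι → ℝ≥0) (hw : ∑ i, w i ≤ 1) (m : ℝ≥0) (hm : 2 * m ^ p = ∑ i, w i * x i ^ p) :
    K * ψ m ≤ ∑ i, w i * ψ (x i) := by
  rcases eq_or_ne m 0 with rfl | hm0
  · simp [h0]
  -- This replaces the tangent line of Jensen's proof: growth from `m` to `x i` gives the first
  -- term, monotonicity of the power gives the second. After averaging, the factor `2` in `hm` pays
  -- for the second term.
  have key : ∀ i, K * ψ m * x i ^ p ≤ m ^ p * ψ (x i) + K * ψ m * m ^ p := by
    intro i
    rcases le_total m (x i) with h | h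
    · have h1 := hs (x i / m) m ((one_le_div₀ hm0.bot_lt).2 h)
      rw [div_mul_cancel₀ _ hm0, NNReal.div_rpow] at h1
      have hmp : m ^ p ≠ 0 := by simp [hm0]
      calc K * ψ m * x i ^ p = m ^ p * (K * (x i ^ p / m ^ p) * ψ m) := by field_simp
        _ ≤ m ^ p * ψ (x i) := by gcongr
        _ ≤ _ := le_self_add
    · exact (mul_le_mul_right (NNReal.rpow_le_rpow h hp.le) _).trans le_add_self
  have h2 : K * ψ m * (2 * m ^ p) ≤ m ^ p * (∑ i, w i * ψ (x i)) + K * ψ m * m ^ p := by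
    calc K * ψ m * (2 * m ^ p) = ∑ i, w i * (K * ψ m * x i ^ p) := by
          rw [hm, Finset.mul_sum]; exact Finset.sum_congr rfl fun i _ => by ring
      _ ≤ ∑ i, w i * (m ^ p * ψ (x i) + K * ψ m * m ^ p) :=
          Finset.sum_le_sum fun i _ => mul_le_mul_right (key i) _
      _ = m ^ p * (∑ i, w i * ψ (x i)) + (∑ i, w i) * (K * ψ m * m ^ p) := by
          rw [Finset.mul_sum, Finset.sum_mul, ← Finset.sum_add_distrib]
          exact Finset.sum_congr rfl fun i _ => by ring
      _ ≤ m ^ p * (∑ i, w i * ψ (x i)) + 1 * (K * ψ m * m ^ p) := by gcongr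
      _ = _ := by rw [one_mul]
  have h3 : m ^ p * (K * ψ m) ≤ m ^ p * (∑ i, w i * ψ (x i)) := by
    have : m ^ p * (K * ψ m) + K * ψ m * m ^ p ≤
        m ^ p * (∑ i, w i * ψ (x i)) + K * ψ m * m ^ p := by
      refine le_trans (le_of_eq ?_) h2; ring
    exact le_of_add_le_add_right this
  exact le_of_mul_le_mul_left h3 (by positivity)

/-- Doubling forces at most polynomial growth, of degree `m` when `D < 2 ^ m`, and `l ^ m ≤ m! * exp
l`. The exponential form suits sign sums, whose exponential moments factor over the coordinates. -/
theorem exists_exp_bound_of_doubling (D : ℝ≥0) : ∃ C : ℝ≥0, 0 < C ∧ ∀ ψ : ℝ≥0 → ℝ≥0, Monotone ψ →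
    (∀ u, ψ (2 * u) ≤ D * ψ u) → ∀ l s : ℝ≥0, (ψ (l * s) : ℝ) ≤ C * Real.exp l * ψ s := by
  obtain ⟨m, hm⟩ := pow_unbounded_of_one_lt D (one_lt_two : (1 : ℝ≥0) < 2)
  refine ⟨2 ^ m * m.factorial + 1, by positivity, fun ψ hψ hD l s => ?_⟩
  have hexp : (1 : ℝ) ≤ Real.exp l := Real.one_le_exp l.2
  rcases le_or_gt l 1 with hl | hl
  · have h1 : (ψ (l * s) : ℝ) ≤ ψ s := by
      exact_mod_cast hψ (mul_le_of_le_one_left zero_le hl)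
    refine h1.trans (le_mul_of_one_le_left (ψ s).2 ?_)
    push_cast
    nlinarith [show (0 : ℝ) ≤ 2 ^ m * m.factorial by positivity]
  · obtain ⟨n, hn1, hn2⟩ := exists_nat_pow_near hl.le (one_lt_two : (1 : ℝ≥0) < 2)
    have hit : ∀ n : ℕ, ∀ u, ψ (2 ^ n * u) ≤ D ^ n * ψ u := by
      intro n
      induction n with
      | zero => intro u; simp
      | succ n ih =>
        intro u
        rw [pow_succ', mul_assoc]
        refine (hD _).trans ((mul_le_mul_right (ih u) _).trans (le_of_eq ?_))
        ring
    have h1 : ψ (l * s) ≤ (2 * l) ^ m * ψ s := by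
      refine (hψ (mul_le_mul_left hn2.le s)).trans ((hit _ _).trans (mul_le_mul_left ?_ _))
      calc D ^ (n + 1) ≤ (2 ^ m) ^ (n + 1) := pow_le_pow_left' hm.le _
        _ = (2 * 2 ^ n) ^ m := by rw [← pow_mul, ← pow_succ', ← pow_mul, mul_comm]
        _ ≤ _ := by gcongr
    have h2 : (l : ℝ) ^ m ≤ m.factorial * Real.exp l := by
      have := Real.pow_div_factorial_le_exp (x := l) l.2 m
      rwa [div_le_iff₀' (by positivity)] at this
    have h3 : (ψ (l * s) : ℝ) ≤ (2 * l) ^ m * ψ s := by exact_mod_cast h1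
    refine h3.trans (mul_le_mul_of_nonneg_right ?_ (ψ s).2)
    rw [mul_pow]
    push_cast
    nlinarith [show (0 : ℝ) < 2 ^ m by positivity]

theorem sum_exp_sum_boolSign (n : ℕ) (a : Fin n → ℝ) :
    ∑ s : Fin n → Bool, Real.exp (∑ k, boolSign (s k) * a k) ≤
      2 ^ n * Real.exp ((∑ k, a k ^ 2) / 2) := by
  have h1 : ∑ s : Fin n → Bool, Real.exp (∑ k, boolSign (s k) * a k) =
      ∏ k, ∑ b : Bool, Real.exp (boolSign b * a k) := by
    simp only [Real.exp_sum]
    rw [Finset.prod_univ_sum, Fintype.piFinset_univ]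
  have h2 : ∀ k, ∑ b : Bool, Real.exp (boolSign b * a k) = 2 * Real.cosh (a k) := by
    intro k
    rw [Real.cosh_eq]
    simp [boolSign]
    ring
  rw [h1]
  simp only [h2, Finset.prod_mul_distrib, Finset.prod_const, Finset.card_univ, Fintype.card_fin]
  rw [Finset.sum_div, Real.exp_sum]
  gcongr with k
  exact Real.cosh_le_exp_half_sq _

theorem sum_exp_abs_sum_boolSign (n : ℕ) (a : Fin n → ℝ) :
    ∑ s : Fin n → Bool, Real.exp |∑ k, boolSign (s k) * a k| ≤
      2 ^ n * (2 * Real.exp ((∑ k, a k ^ 2) / 2)) := by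
  have h1 := sum_exp_sum_boolSign n a
  have h2 := sum_exp_sum_boolSign n (fun k => - a k)
  simp only [neg_sq, mul_neg, Finset.sum_neg_distrib] at h2
  calc _ ≤ ∑ s : Fin n → Bool, (Real.exp (∑ k, boolSign (s k) * a k) +
        Real.exp (-∑ k, boolSign (s k) * a k)) := by
        refine Finset.sum_le_sum fun s _ => ?_
        rcases abs_choice (∑ k, boolSign (s k) * a k) with h | h <;> rw [h]
        · exact le_add_of_nonneg_right (Real.exp_nonneg _)
        · exact le_add_of_nonneg_left (Real.exp_nonneg _)
    _ ≤ _ := by rw [Finset.sum_add_distrib]; linarith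

/-- Khintchine's inequality for functions with the doubling property. -/
theorem khintchine_of_doubling (D : ℝ≥0) : ∃ C : ℝ≥0, 0 < C ∧ ∀ ψ : ℝ≥0 → ℝ≥0, Monotone ψ → ψ 0 = 0 →
    (∀ u, ψ (2 * u) ≤ D * ψ u) → ∀ (n : ℕ) (a : Fin n → ℝ),
      ∑ s : Fin n → Bool, ψ ‖∑ k, boolSign (s k) * a k‖₊ ≤
        2 ^ n * (C * ψ ((∑ k, ‖a k‖₊ ^ (2 : ℝ)) ^ (1 / 2 : ℝ))) := by
  obtain ⟨C, hC, h⟩ := exists_exp_bound_of_doubling D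
  refine ⟨C * (2 * Real.toNNReal (Real.exp (1 / 2))), by positivity, fun ψ hψ h0 hD n a => ?_⟩
  set q : ℝ≥0 := (∑ k, ‖a k‖₊ ^ (2 : ℝ)) ^ (1 / 2 : ℝ) with hq
  have hq2 : (q : ℝ) ^ 2 = ∑ k, a k ^ 2 := by
    have : q ^ (2 : ℝ) = ∑ k, ‖a k‖₊ ^ (2 : ℝ) := by
      rw [hq, ← NNReal.rpow_mul]; norm_num
    rw [NNReal.rpow_two] at this
    have h' := congrArg (fun x : ℝ≥0 => (x : ℝ)) this
    simpa using h'
  rcases eq_or_ne q 0 with hq0 | hq0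
  · have ha : ∀ k, a k = 0 := by
      intro k
      rw [hq0] at hq2
      have := (Finset.sum_eq_zero_iff_of_nonneg (fun k _ => sq_nonneg (a k))).1
        (by simpa using hq2.symm) k (Finset.mem_univ k)
      simpa using this
    simp [ha, h0]
  have hq0' : (0 : ℝ) < q := NNReal.coe_pos.2 hq0.bot_lt
  rw [← NNReal.coe_le_coe]
  push_cast
  -- The scale is the `ℓ²` norm `q`: the coefficients `a k / q` have square sum `1`, so the
  -- exponential moments are at most `2 * exp (1 / 2)` on average.
  calc ∑ s : Fin n → Bool, (ψ ‖∑ k, boolSign (s k) * a k‖₊ : ℝ)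
      ≤ ∑ s : Fin n → Bool, C * Real.exp |∑ k, boolSign (s k) * (a k / q)| * ψ q := by
        refine Finset.sum_le_sum fun s _ => ?_
        have h1 := h ψ hψ hD ‖∑ k, boolSign (s k) * (a k / q)‖₊ q
        have h2 : ‖∑ k, boolSign (s k) * (a k / q)‖₊ * q = ‖∑ k, boolSign (s k) * a k‖₊ := by
          ext
          push_cast
          simp only [← mul_div_assoc]
          rw [← Finset.sum_div, norm_div, Real.norm_of_nonneg hq0'.le, div_mul_cancel₀ _ hq0'.ne']
        rw [h2] at h1
        exact h1
    _ = C * ψ q * ∑ s : Fin n → Bool, Real.exp |∑ k, boolSign (s k) * (a k / q)| := by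
        rw [Finset.mul_sum]; exact Finset.sum_congr rfl fun s _ => by ring
    _ ≤ C * ψ q * (2 ^ n * (2 * Real.exp ((∑ k, (a k / q) ^ 2) / 2))) := by
        gcongr; exact sum_exp_abs_sum_boolSign n _
    _ = _ := by
        have : ∑ k, (a k / q) ^ 2 = 1 := by
          simp only [div_pow]
          rw [← Finset.sum_div, ← hq2, div_self (by positivity)]
        rw [this, Real.coe_toNNReal _ (Real.exp_nonneg _)]
        ring

theorem nnnorm_sum_boolSign_le {n : ℕ} (s : Fin n → Bool) (a : Fin n → ℝ) {p : ℝ} (hp : 0 < p)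
    (hp1 : p ≤ 1) : ‖∑ k, boolSign (s k) * a k‖₊ ≤ (∑ k, ‖a k‖₊ ^ p) ^ (1 / p) := by
  refine (nnnorm_sum_le _ _).trans ?_
  simpa [nnnorm_mul, nnnorm_boolSign] using
    NNReal.rpow_sum_rpow_le_of_le Finset.univ (fun k => ‖a k‖₊) hp hp1

/-! ### Type for modulars, from the growth conditions. -/

/-- A modular form of Rademacher type, for a function `ψ` that need not be an Orlicz function. -/
def HasModularType {Ω : Type*} [MeasurableSpace Ω] (ψ : ℝ≥0 → ℝ≥0) (μ : Measure Ω) (p : ℝ) : Prop :=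
  ∃ C : ℝ≥0, 0 < C ∧ ∀ (n : ℕ) (f : Fin n → Ω → ℝ) (c : Fin n → ℝ≥0), (∀ k, Measurable (f k)) →
    (∀ k, 0 < c k) → ∑ k, c k ^ p ≤ 1 → (∀ k, ∫⁻ t, (ψ (‖f k t‖₊ / c k) : ℝ≥0∞) ∂μ ≤ 1) →
      ∃ d : (Fin n → Bool) → ℝ≥0, (∀ s, 0 < d s ∧
        ∫⁻ t, (ψ (‖∑ k, boolSign (s k) * f k t‖₊ / d s) : ℝ≥0∞) ∂μ ≤ 1) ∧ ∑ s, d s ≤ 2 ^ n * C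

section Growth

variable {Ω : Type*} [MeasurableSpace Ω] {μ : Measure Ω} {ψ : ℝ≥0 → ℝ≥0} {K : ℝ≥0} {p : ℝ}

/-- Dividing the function by `l ≥ 1` divides its modular by at least `K * l ^ p`. This is how a
bound on a modular becomes a bound on a quasi-norm. -/
theorem lintegral_div_le (hK : 0 < K)
    (hs : ∀ a u : ℝ≥0, 1 ≤ a → K * a ^ p * ψ u ≤ ψ (a * u)) {g : Ω → ℝ≥0} {I J l : ℝ≥0}
    (hI : ∫⁻ t, (ψ (g t) : ℝ≥0∞) ∂μ ≤ I) (hl : 1 ≤ l) (hIl : I ≤ K * l ^ p * J) :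
    ∫⁻ t, (ψ (g t / l) : ℝ≥0∞) ∂μ ≤ J := by
  have hl0 : l ≠ 0 := (zero_lt_one.trans_le hl).ne'
  have hpos : K * l ^ p ≠ 0 := by simp [hK.ne', hl0]
  have h1 : ((K * l ^ p : ℝ≥0) : ℝ≥0∞) * ∫⁻ t, (ψ (g t / l) : ℝ≥0∞) ∂μ ≤
      (K * l ^ p : ℝ≥0) * J := by
    rw [← lintegral_const_mul' _ _ ENNReal.coe_ne_top]
    refine (lintegral_mono fun t => ?_).trans (hI.trans (by exact_mod_cast hIl))
    have := hs l (g t / l) hl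
    rw [mul_div_cancel₀ _ hl0] at this
    simpa only [← ENNReal.coe_mul] using ENNReal.coe_le_coe.2 this
  exact (ENNReal.mul_le_mul_iff_right (by exact_mod_cast hpos) ENNReal.coe_ne_top).1 h1

theorem lintegral_div_le_one (hK : 0 < K)
    (hs : ∀ a u : ℝ≥0, 1 ≤ a → K * a ^ p * ψ u ≤ ψ (a * u)) {g : Ω → ℝ≥0} {I l : ℝ≥0}
    (hI : ∫⁻ t, (ψ (g t) : ℝ≥0∞) ∂μ ≤ I) (hl : 1 ≤ l) (hIl : I ≤ K * l ^ p) :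
    ∫⁻ t, (ψ (g t / l) : ℝ≥0∞) ∂μ ≤ 1 :=
  lintegral_div_le (J := 1) hK hs hI hl (by rwa [mul_one])

/-- Weak Jensen with weights `c k ^ p` at the points `x k / c k`: the weighted `p`-th moments are
then `x k ^ p`. The scaling by `2 ^ (1 / p)` provides the factor `2` required there. -/
theorem mul_le_sum_rpow_mul (hp : 0 < p) (h0 : ψ 0 = 0)
    (hs : ∀ a u : ℝ≥0, 1 ≤ a → K * a ^ p * ψ u ≤ ψ (a * u)) {n : ℕ} (x c : Fin n → ℝ≥0)
    (hc : ∀ k, 0 < c k) (hc1 : ∑ k, c k ^ p ≤ 1) :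
    K * ψ ((∑ k, (x k / 2 ^ (1 / p)) ^ p) ^ (1 / p)) ≤ ∑ k, c k ^ p * ψ (x k / c k) := by
  refine mul_le_sum_of_growth hp h0 hs _ _ hc1 _ ?_
  rw [← NNReal.rpow_mul, one_div_mul_cancel hp.ne', NNReal.rpow_one, Finset.mul_sum]
  refine Finset.sum_congr rfl fun k _ => ?_
  have h1 : c k ^ p ≠ 0 := by simp [(hc k).ne']
  rw [NNReal.div_rpow, NNReal.div_rpow, ← NNReal.rpow_mul, one_div_mul_cancel hp.ne',
    NNReal.rpow_one, mul_div_cancel₀ _ two_ne_zero, mul_div_cancel₀ _ h1]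

theorem lintegral_sum_rpow_mul_le (hψ : Monotone ψ) {n : ℕ} (f : Fin n → Ω → ℝ) (c : Fin n → ℝ≥0)
    (hf : ∀ k, Measurable (f k)) (hc1 : ∑ k, c k ^ p ≤ 1)
    (hI : ∀ k, ∫⁻ t, (ψ (‖f k t‖₊ / c k) : ℝ≥0∞) ∂μ ≤ 1) :
    ∫⁻ t, ((∑ k, c k ^ p * ψ (‖f k t‖₊ / c k) : ℝ≥0) : ℝ≥0∞) ∂μ ≤ 1 := by
  have hm : ∀ k, Measurable fun t => (ψ (‖f k t‖₊ / c k) : ℝ≥0∞) := fun k =>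
    (hψ.measurable.comp ((hf k).nnnorm.div_const _)).coe_nnreal_ennreal
  push_cast
  rw [lintegral_finsetSum _ fun k _ => (hm k).const_mul _]
  calc _ ≤ ∑ k, ((c k ^ p : ℝ≥0) : ℝ≥0∞) := by
        refine Finset.sum_le_sum fun k _ => ?_
        rw [lintegral_const_mul _ (hm k)]
        exact mul_le_of_le_one_right' (hI k)
    _ ≤ 1 := by exact_mod_cast hc1

/-- For `p ≤ 1` the pointwise bound of a signed sum by the `ℓ^p` norm holds for every choice of
signs, so one constant `d` serves for all of them and no doubling is used. -/
theorem hasModularType_of_le_one (hψ : Monotone ψ) (h0 : ψ 0 = 0) (hK : 0 < K) (hp : 0 < p)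
    (hp1 : p ≤ 1) (hs : ∀ a u : ℝ≥0, 1 ≤ a → K * a ^ p * ψ u ≤ ψ (a * u)) :
    HasModularType ψ μ p := by
  set θ : ℝ≥0 := 2 ^ (1 / p)
  have hθ : 0 < θ := NNReal.rpow_pos two_pos
  -- Weak Jensen leaves a modular of at most `K⁻¹`; this `l` satisfies `l ≥ 1` and `K * l ^ p = K +
  -- K⁻¹`, so division by `l` brings the modular below `1`.
  set l : ℝ≥0 := (1 + 1 / K ^ 2) ^ (1 / p)
  have hl : 1 ≤ l := NNReal.one_le_rpow le_self_add (by positivity)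
  have hlp : l ^ p = 1 + 1 / K ^ 2 := by
    rw [← NNReal.rpow_mul, one_div_mul_cancel hp.ne', NNReal.rpow_one]
  refine ⟨θ * l, mul_pos hθ (by positivity), fun n f c hf hc hc1 hI => ⟨fun _ => θ * l,
    fun s => ⟨mul_pos hθ (by positivity), ?_⟩, by simp⟩⟩
  simp only [← div_div]
  refine lintegral_div_le_one (I := K⁻¹) hK hs ?_ hl ?_
  · have h1 : (K : ℝ≥0∞) * ∫⁻ t, (ψ (‖∑ k, boolSign (s k) * f k t‖₊ / θ) : ℝ≥0∞) ∂μ ≤ 1 := by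
      rw [← lintegral_const_mul' _ _ ENNReal.coe_ne_top]
      refine (lintegral_mono fun t => ?_).trans (lintegral_sum_rpow_mul_le hψ f c hf hc1 hI)
      have h2 := mul_le_sum_rpow_mul hp h0 hs (fun k => ‖f k t‖₊) c hc hc1
      have h3 : ‖∑ k, boolSign (s k) * f k t‖₊ / θ ≤
          (∑ k, (‖f k t‖₊ / 2 ^ (1 / p)) ^ p) ^ (1 / p) := by
        simp only [NNReal.div_rpow]
        rw [← Finset.sum_div, NNReal.div_rpow]
        have e : ((2 ^ (1 / p) : ℝ≥0) ^ p) ^ (1 / p) = θ := by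
          rw [← NNReal.rpow_mul, mul_one_div_cancel hp.ne', NNReal.rpow_one]
        rw [e]
        gcongr
        exact nnnorm_sum_boolSign_le s (fun k => f k t) hp hp1
      simpa only [← ENNReal.coe_mul] using
        ENNReal.coe_le_coe.2 ((mul_le_mul_right (hψ h3) K).trans h2)
    rw [ENNReal.coe_inv hK.ne']
    rwa [ENNReal.le_inv_iff_mul_le, mul_comm]
  · rw [hlp]
    have : K * (1 + 1 / K ^ 2) = K + K⁻¹ := by field_simp
    rw [this]
    exact le_add_self

/-- Pointwise, Khintchine bounds the average over signs by `ψ` of the `ℓ²` norm, which is at most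
the `ℓ^p` norm as `p ≤ 2`, and weak Jensen applies. Integration bounds the average of the modulars
`I s`. -/
theorem hasModularType_of_one_le (hψ : Monotone ψ) (h0 : ψ 0 = 0) (hK : 0 < K) (hp : 1 ≤ p)
    (hp2 : p ≤ 2) (hs : ∀ a u : ℝ≥0, 1 ≤ a → K * a ^ p * ψ u ≤ ψ (a * u)) {D : ℝ≥0}
    (hD : ∀ u, ψ (2 * u) ≤ D * ψ u) : HasModularType ψ μ p := by
  have hp0 : 0 < p := by linarith
  set θ : ℝ≥0 := 2 ^ (1 / p)
  have hθ : 0 < θ := NNReal.rpow_pos two_pos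
  obtain ⟨C, hC, hkh⟩ := khintchine_of_doubling D
  refine ⟨θ * (1 + C / K / K), mul_pos hθ (by positivity), fun n f c hf hc hc1 hI => ?_⟩
  set I : (Fin n → Bool) → ℝ≥0∞ := fun s =>
    ∫⁻ t, (ψ (‖∑ k, boolSign (s k) * f k t‖₊ / θ) : ℝ≥0∞) ∂μ with hIdef
  have hpt : ∀ t, ∑ s : Fin n → Bool, ψ (‖∑ k, boolSign (s k) * f k t‖₊ / θ) ≤
      2 ^ n * (C / K) * ∑ k, c k ^ p * ψ (‖f k t‖₊ / c k) := by
    intro t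
    have h1 := hkh ψ hψ h0 hD n (fun k => f k t / θ)
    have h2 := mul_le_sum_rpow_mul hp0 h0 hs (fun k => ‖f k t‖₊) c hc hc1
    have hn : ∀ x : ℝ, ‖x / θ‖₊ = ‖x‖₊ / θ := by intro x; rw [nnnorm_div]; simp
    have h3 := NNReal.rpow_sum_rpow_le_of_le Finset.univ (fun k => ‖f k t / θ‖₊) hp0 hp2
    simp only [← mul_div_assoc, ← Finset.sum_div, hn] at h1 h3
    refine h1.trans ?_
    calc _ ≤ 2 ^ n * (C * ψ ((∑ k, (‖f k t‖₊ / θ) ^ p) ^ (1 / p))) := by gcongr; exact hψ h3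
      _ = 2 ^ n * (C / K) * (K * ψ ((∑ k, (‖f k t‖₊ / θ) ^ p) ^ (1 / p))) := by field_simp
      _ ≤ _ := by gcongr
  have hsum : ∑ s, I s ≤ ((2 ^ n * (C / K) : ℝ≥0) : ℝ≥0∞) := by
    have hm : ∀ s : Fin n → Bool,
        Measurable fun t => (ψ (‖∑ k, boolSign (s k) * f k t‖₊ / θ) : ℝ≥0∞) := fun s =>
      (hψ.measurable.comp ((Finset.measurable_fun_sum _
        fun k _ => (hf k).const_mul _).nnnorm.div_const _)).coe_nnreal_ennreal
    rw [← lintegral_finsetSum _ fun s _ => hm s]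
    calc _ ≤ ∫⁻ t, ((2 ^ n * (C / K) : ℝ≥0) : ℝ≥0∞) *
          ((∑ k, c k ^ p * ψ (‖f k t‖₊ / c k) : ℝ≥0) : ℝ≥0∞) ∂μ :=
          lintegral_mono fun t => by
            rw [← ENNReal.coe_mul, ← ENNReal.ofNNReal_finsetSum]
            exact ENNReal.coe_le_coe.2 (hpt t)
      _ ≤ _ := by
          rw [lintegral_const_mul' _ _ ENNReal.coe_ne_top]
          exact mul_le_of_le_one_right' (lintegral_sum_rpow_mul_le hψ f c hf hc1 hI)
  have hfin : ∀ s, I s ≠ ∞ := fun s =>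
    (((Finset.single_le_sum (fun _ _ => zero_le) (Finset.mem_univ s)).trans hsum).trans_lt
      ENNReal.coe_lt_top).ne
  -- Since `p ≥ 1`, the first power of `1 + I s / K` already suffices to normalise the modular `I
  -- s`. This choice is affine in `I s`, so its average is controlled by that of `I s`.
  refine ⟨fun s => θ * (1 + (I s).toNNReal / K), fun s => ⟨mul_pos hθ (by positivity), ?_⟩, ?_⟩
  · simp only [← div_div]
    have h1 : 1 ≤ 1 + (I s).toNNReal / K := le_self_add
    refine lintegral_div_le_one (I := (I s).toNNReal) hK hs ?_ h1 ?_
    · rw [ENNReal.coe_toNNReal (hfin s)]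
    · calc (I s).toNNReal = K * ((I s).toNNReal / K) := by field_simp
        _ ≤ K * (1 + (I s).toNNReal / K) ^ (1 : ℝ) := by
            rw [NNReal.rpow_one]; gcongr; exact le_add_self
        _ ≤ _ := by gcongr
  · have h1 : ∑ s, (I s).toNNReal ≤ 2 ^ n * (C / K) := by
      rw [← ENNReal.coe_le_coe]
      refine le_trans (le_of_eq ?_) hsum
      push_cast
      exact Finset.sum_congr rfl fun s _ => ENNReal.coe_toNNReal (hfin s)
    rw [← Finset.mul_sum, Finset.sum_add_distrib, ← Finset.sum_div]
    calc _ ≤ θ * (2 ^ n + 2 ^ n * (C / K) / K) := by gcongr; simp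
      _ = _ := by ring

theorem hasModularType_of_growth (hψ : Monotone ψ) (h0 : ψ 0 = 0) (hK : 0 < K) (hp : 0 < p)
    (hp2 : p ≤ 2) (hs : ∀ a u : ℝ≥0, 1 ≤ a → K * a ^ p * ψ u ≤ ψ (a * u)) {D : ℝ≥0}
    (hD : ∀ u, ψ (2 * u) ≤ D * ψ u) : HasModularType ψ μ p := by
  rcases le_total p 1 with h | h
  · exact hasModularType_of_le_one hψ h0 hK hp h hs
  · exact hasModularType_of_one_le hψ h0 hK h hp2 hs hD

/-- Only the modular unit balls have to be comparable up to scaling, not the functions `ψ` and `χ`;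
this permits altering `φ` on a range of arguments. -/
theorem HasModularType.of_equivalent {χ : ℝ≥0 → ℝ≥0} (h : HasModularType χ μ p) {A B : ℝ≥0}
    (hA : 0 < A) (hB : 0 < B)
    (h1 : ∀ g : Ω → ℝ≥0, Measurable g → ∫⁻ t, (ψ (g t) : ℝ≥0∞) ∂μ ≤ 1 →
      ∫⁻ t, (χ (g t / A) : ℝ≥0∞) ∂μ ≤ 1)
    (h2 : ∀ g : Ω → ℝ≥0, Measurable g → ∫⁻ t, (χ (g t) : ℝ≥0∞) ∂μ ≤ 1 →
      ∫⁻ t, (ψ (g t / B) : ℝ≥0∞) ∂μ ≤ 1) : HasModularType ψ μ p := by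
  obtain ⟨C, hC, H⟩ := h
  refine ⟨A * B * C, by positivity, fun n f c hf hc hc1 hI => ?_⟩
  have hA' : ‖(A : ℝ)‖₊ = A := by simp
  obtain ⟨d, hd, hd2⟩ := H n (fun k t => f k t / A) c (fun k => (hf k).div_const _) hc hc1
    (fun k => by
      have := h1 (fun t => ‖f k t‖₊ / c k) ((hf k).nnnorm.div_const _) (hI k)
      simpa only [nnnorm_div, hA', div_right_comm] using this)
  refine ⟨fun s => A * B * d s, fun s => ⟨mul_pos (mul_pos hA hB) (hd s).1, ?_⟩, ?_⟩
  · have h3 := h2 (fun t => ‖∑ k, boolSign (s k) * (f k t / A)‖₊ / d s)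
      ((Finset.measurable_fun_sum _ fun k _ =>
        ((hf k).div_const _).const_mul _).nnnorm.div_const _) (hd s).2
    simp only [← mul_div_assoc, ← Finset.sum_div, nnnorm_div, hA', div_div] at h3
    have e : A * B * d s = A * d s * B := by ring
    simpa only [e] using h3
  · rw [← Finset.mul_sum]
    calc _ ≤ A * B * (2 ^ n * C) := by gcongr
      _ = _ := by ring

end Growth

/-! ### From modular type to Rademacher type. -/

namespace OrliczFunction

variable {Ω : Type*} [MeasurableSpace Ω] {μ : Measure Ω} (φ : OrliczFunction)

theorem modular_inv_smul (f : Ω →ₘ[μ] ℝ) (c : ℝ≥0) :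
    φ.modular ((c : ℝ)⁻¹ • f) = ∫⁻ t, (φ (‖f t‖₊ / c) : ℝ≥0∞) ∂μ := by
  unfold modular
  refine lintegral_congr_ae ?_
  filter_upwards [AEEqFun.coeFn_smul (c : ℝ)⁻¹ f] with t h
  rw [h, Pi.smul_apply, nnnorm_smul]
  simp [div_eq_inv_mul]

theorem quasiNorm_le {f : φ.orliczSpace μ} {d : ℝ≥0} (hd : 0 < d)
    (h : ∫⁻ t, (φ (‖(f : Ω →ₘ[μ] ℝ) t‖₊ / d) : ℝ≥0∞) ∂μ ≤ 1) : φ.quasiNorm f ≤ d :=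
  csInf_le ⟨0, fun _ hx => hx.1.le⟩ ⟨hd, by rwa [modular_inv_smul]⟩

/-- A modular that is finite at one scale tends to `0` as the scale grows, by dominated convergence.
Hence the infimum defining the quasi-norm runs over a nonempty set. -/
theorem exists_modular_le_one (f : φ.orliczSpace μ) :
    ∃ d : ℝ, 0 < d ∧ φ.modular (d⁻¹ • (f : Ω →ₘ[μ] ℝ)) ≤ 1 := by
  obtain ⟨l, hl, hfin⟩ := f.2
  lift l to ℝ≥0 using hl.le
  have hl0 : 0 < l := by exact_mod_cast hl
  have hgm : ∀ c : ℝ≥0, AEMeasurable (fun t => (φ (‖(f : Ω →ₘ[μ] ℝ) t‖₊ / c) : ℝ≥0∞)) μ := fun c =>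
    (φ.continuous.measurable.comp_aemeasurable
      ((f : Ω →ₘ[μ] ℝ).aestronglyMeasurable.aemeasurable.nnnorm.div_const _)).coe_nnreal_ennreal
  have hfin' : ∫⁻ t, (φ (‖(f : Ω →ₘ[μ] ℝ) t‖₊ / l⁻¹) : ℝ≥0∞) ∂μ ≠ ∞ := by
    rw [← modular_inv_smul]; simpa using hfin.ne
  have hlim : Tendsto (fun n : ℕ => ∫⁻ t, (φ (‖(f : Ω →ₘ[μ] ℝ) t‖₊ / (l⁻¹ + n)) : ℝ≥0∞) ∂μ) atTop
      (nhds (∫⁻ _, 0 ∂μ)) := by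
    refine tendsto_lintegral_of_dominated_convergence' _ (fun n => hgm _) (fun n => ?_) hfin' ?_
    · refine Eventually.of_forall fun t => ENNReal.coe_le_coe.2 (φ.strictMono.monotone ?_)
      exact div_le_div_of_nonneg_left zero_le (inv_pos.2 hl0) le_self_add
    · refine Eventually.of_forall fun t => ?_
      rw [← ENNReal.coe_zero, ENNReal.tendsto_coe, ← φ.map_zero]
      refine (φ.continuous.tendsto 0).comp ?_
      rw [← NNReal.tendsto_coe]
      push_cast
      exact tendsto_const_nhds.div_atTop
        (tendsto_atTop_add_const_left atTop _ (tendsto_natCast_atTop_atTop (R := ℝ)))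
  rw [lintegral_zero] at hlim
  obtain ⟨n, hn⟩ := (hlim.eventually (ge_mem_nhds zero_lt_one)).exists
  refine ⟨((l⁻¹ + n : ℝ≥0) : ℝ), ?_, ?_⟩
  · exact_mod_cast (inv_pos.2 hl0).trans_le le_self_add
  · rwa [modular_inv_smul]

theorem quasiNorm_nonneg (f : φ.orliczSpace μ) : 0 ≤ φ.quasiNorm f :=
  Real.sInf_nonneg fun _ hx => hx.1.le

theorem lintegral_le_one_of_quasiNorm_lt {f : φ.orliczSpace μ} {c : ℝ≥0} (h : φ.quasiNorm f < c) :
    ∫⁻ t, (φ (‖(f : Ω →ₘ[μ] ℝ) t‖₊ / c) : ℝ≥0∞) ∂μ ≤ 1 := by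
  obtain ⟨d, ⟨hd, hd1⟩, hdc⟩ := exists_lt_of_csInf_lt (φ.exists_modular_le_one f) h
  lift d to ℝ≥0 using hd.le
  rw [modular_inv_smul] at hd1
  refine (lintegral_mono fun t => ENNReal.coe_le_coe.2 (φ.strictMono.monotone ?_)).trans hd1
  exact div_le_div_of_nonneg_left zero_le (by exact_mod_cast hd) (by exact_mod_cast hdc.le)

theorem le_quasiNorm {f : φ.orliczSpace μ} {b : ℝ≥0}
    (h : ∀ c : ℝ≥0, 0 < c → c < b → 1 < ∫⁻ t, (φ (‖(f : Ω →ₘ[μ] ℝ) t‖₊ / c) : ℝ≥0∞) ∂μ) :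
    b ≤ φ.quasiNorm f := by
  refine le_csInf (φ.exists_modular_le_one f) fun d ⟨hd, hd1⟩ => ?_
  lift d to ℝ≥0 using hd.le
  by_contra! hlt
  rw [modular_inv_smul] at hd1
  exact (h d (by exact_mod_cast hd) (by exact_mod_cast hlt)).not_ge hd1

theorem _root_.hasRademacherType_iff_sum {X : Type*} [AddCommGroup X] [Module ℝ X] (N : X → ℝ)
    (p : ℝ) : HasRademacherType N p ↔ ∃ K : ℝ, 0 < K ∧ ∀ (n : ℕ) (x : Fin n → X),
      (1 / 2 ^ n) * ∑ s : Fin n → Bool, N (∑ k, boolSign (s k) • x k)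
        ≤ K * (∑ k : Fin n, N (x k) ^ p) ^ (1 / p) := by
  unfold HasRademacherType
  have h : ∀ (n : ℕ) (x : Fin n → X),
      ∫ t in (0 : ℝ)..1, N (∑ k : Fin n, rademacher (k + 1) t • x k) =
        (1 / 2 ^ n) * ∑ s : Fin n → Bool, N (∑ k, boolSign (s k) • x k) := fun n x =>
    (hasIntegral_rademacher n (fun r => N (∑ k, r k • x k))).2
  simp only [h]

theorem coeFn_sum_smul {n : ℕ} (r : Fin n → ℝ) (x : Fin n → φ.orliczSpace μ) :
    (((∑ k, r k • x k : φ.orliczSpace μ) : Ω →ₘ[μ] ℝ) : Ω → ℝ) =ᵐ[μ]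
      fun t => ∑ k, r k * (x k : Ω →ₘ[μ] ℝ) t := by
  induction n with
  | zero =>
    simp only [Finset.univ_eq_empty, Finset.sum_empty]
    exact AEEqFun.coeFn_zero
  | succ n ih =>
    simp only [Fin.sum_univ_succ]
    rw [Submodule.coe_add, Submodule.coe_smul]
    filter_upwards [AEEqFun.coeFn_add (r 0 • (x 0 : Ω →ₘ[μ] ℝ))
      ((∑ k : Fin n, r k.succ • x k.succ : φ.orliczSpace μ) : Ω →ₘ[μ] ℝ),
      AEEqFun.coeFn_smul (r 0) (x 0 : Ω →ₘ[μ] ℝ),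
      ih (fun k => r k.succ) (fun k => x k.succ)] with t h1 h2 h3
    rw [h1, Pi.add_apply, h2, h3]
    rfl

/-- The quasi-norms are enlarged to positive `c k` with `c k ^ p` exceeding by `δ`, normalised by
`γ` to have `p`-sum at most `1`, and `δ` tends to `0`. -/
theorem hasRademacherType_of_hasModularType {p : ℝ} (hp : 0 < p) (h : HasModularType φ μ p) :
    HasRademacherType (φ.quasiNorm (μ := μ)) p := by
  rw [hasRademacherType_iff_sum]
  obtain ⟨C, hC, H⟩ := h
  refine ⟨C, by exact_mod_cast hC, fun n x => ?_⟩
  have hN : ∀ k, 0 ≤ φ.quasiNorm (x k) := fun k => φ.quasiNorm_nonneg _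
  set S := ∑ k, φ.quasiNorm (x k) ^ p with hS
  have hS0 : 0 ≤ S := Finset.sum_nonneg fun k _ => Real.rpow_nonneg (hN k) p
  have key : ∀ δ : ℝ, 0 < δ → (1 / 2 ^ n) * ∑ s : Fin n → Bool,
      φ.quasiNorm (∑ k, boolSign (s k) • x k) ≤ C * (S + (n + 1) * δ) ^ (1 / p) := by
    intro δ hδ
    -- The perturbations add up to `n * δ`; the extra `δ` keeps `γ` positive even for the empty
    -- family.
    set γ : ℝ≥0 := Real.toNNReal ((S + (n + 1) * δ) ^ (1 / p)) with hγ
    have hγr : (γ : ℝ) = (S + (n + 1) * δ) ^ (1 / p) := Real.coe_toNNReal _ (by positivity)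
    have hγ0 : 0 < γ := by rw [← NNReal.coe_pos, hγr]; positivity
    set c : Fin n → ℝ≥0 := fun k => Real.toNNReal ((φ.quasiNorm (x k) ^ p + δ) ^ (1 / p)) with hcdef
    have hcr : ∀ k, (c k : ℝ) = (φ.quasiNorm (x k) ^ p + δ) ^ (1 / p) := fun k =>
      Real.coe_toNNReal _ (by have := Real.rpow_nonneg (hN k) p; positivity)
    have hc0 : ∀ k, 0 < c k := fun k => by
      rw [← NNReal.coe_pos, hcr]; have := Real.rpow_nonneg (hN k) p; positivity
    have hlt : ∀ k, φ.quasiNorm (x k) < c k := fun k => by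
      rw [hcr]
      calc φ.quasiNorm (x k) = (φ.quasiNorm (x k) ^ p) ^ (1 / p) := by
            rw [← Real.rpow_mul (hN k), mul_one_div_cancel hp.ne', Real.rpow_one]
        _ < _ := Real.rpow_lt_rpow (Real.rpow_nonneg (hN k) p) (by linarith) (by positivity)
    have hsum : ∑ k, (c k / γ) ^ p ≤ 1 := by
      simp only [NNReal.div_rpow]
      rw [← Finset.sum_div]
      refine div_le_one_of_le₀ ?_ zero_le
      rw [← NNReal.coe_le_coe]
      push_cast
      rw [hγr]
      simp only [hcr]
      rw [← Real.rpow_mul (by positivity), one_div_mul_cancel hp.ne', Real.rpow_one]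
      have e : ∀ k, ((φ.quasiNorm (x k) ^ p + δ) ^ (1 / p)) ^ p = φ.quasiNorm (x k) ^ p + δ := by
        intro k
        have := Real.rpow_nonneg (hN k) p
        rw [← Real.rpow_mul (by positivity), one_div_mul_cancel hp.ne', Real.rpow_one]
      simp only [e]
      rw [Finset.sum_add_distrib, ← hS]
      simp
      linarith
    have hγn : ‖(γ : ℝ)‖₊ = γ := by simp
    obtain ⟨d, hd, hd2⟩ := H n (fun k t => (x k : Ω →ₘ[μ] ℝ) t / γ) (fun k => c k / γ)
      (fun k => (x k : Ω →ₘ[μ] ℝ).measurable.div_const _) (fun k => div_pos (hc0 k) hγ0) hsum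
      (fun k => by
        have := φ.lintegral_le_one_of_quasiNorm_lt (hlt k)
        simpa only [nnnorm_div, hγn, div_div_div_cancel_right₀ hγ0.ne'] using this)
    have hle : ∀ s, φ.quasiNorm (∑ k, boolSign (s k) • x k) ≤ ((γ * d s : ℝ≥0) : ℝ) := by
      intro s
      refine φ.quasiNorm_le (mul_pos hγ0 (hd s).1) (le_trans (le_of_eq ?_) (hd s).2)
      refine lintegral_congr_ae ?_
      filter_upwards [φ.coeFn_sum_smul (fun k => boolSign (s k)) x] with t ht
      simp only [← mul_div_assoc, ← Finset.sum_div, nnnorm_div, hγn]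
      rw [ht, div_div]
    have hd2' : ∑ s, (d s : ℝ) ≤ 2 ^ n * C := by exact_mod_cast hd2
    calc _ ≤ (1 / 2 ^ n : ℝ) * ∑ s, ((γ * d s : ℝ≥0) : ℝ) := by
          gcongr with s; exact hle s
      _ = (1 / 2 ^ n : ℝ) * (γ * ∑ s, (d s : ℝ)) := by
          push_cast; rw [← Finset.mul_sum]
      _ ≤ (1 / 2 ^ n : ℝ) * (γ * (2 ^ n * C)) := by gcongr
      _ = C * γ := by field_simp
      _ = _ := by rw [hγr]
  have hcont : Tendsto (fun δ : ℝ => (C : ℝ) * (S + (n + 1) * δ) ^ (1 / p)) (nhdsWithin 0 (Set.Ioi 0))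
      (nhds (C * (S + (n + 1) * 0) ^ (1 / p))) := by
    refine Tendsto.mono_left (Continuous.tendsto ?_ 0) nhdsWithin_le_nhds
    exact continuous_const.mul (Continuous.rpow_const (by fun_prop) fun _ => Or.inr (by positivity))
  rw [mul_zero, add_zero] at hcont
  exact ge_of_tendsto hcont (eventually_mem_nhdsWithin.mono fun δ hδ => key δ hδ)

end OrliczFunction

/-! ### Moving thresholds and replacing `φ` by a power on part of its domain. -/

namespace OrliczFunction

variable {Ω : Type*} [MeasurableSpace Ω] {μ : Measure Ω} {φ : OrliczFunction} {p : ℝ}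

theorem pos_of_pos (φ : OrliczFunction) {u : ℝ≥0} (hu : 0 < u) : 0 < φ u := by
  simpa [φ.map_zero] using φ.strictMono hu

/-- The threshold can be lowered to any positive `v` at the cost of a factor `(v / V) ^ p`. If `a *
u` stays below `V`, then `a ≤ V / v` and monotonicity suffices; if it crosses `V`, the condition is
applied starting from `V`. -/
theorem DeltaStar.exists_large (h : φ.DeltaStar p .large) (hp : 0 < p) {v : ℝ≥0} (hv : 0 < v) :
    ∃ K : ℝ≥0, 0 < K ∧ ∀ a u : ℝ≥0, 1 ≤ a → v ≤ u → K * a ^ p * φ u ≤ φ (a * u) := by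
  obtain ⟨K₀, hK₀, v₀, h⟩ := h
  set V := max v₀ v
  have hV : 0 < V := hv.trans_le (le_max_right _ _)
  have hvV : (v / V) ^ p ≤ 1 :=
    NNReal.rpow_le_one (div_le_one_of_le₀ (le_max_right _ _) zero_le) hp.le
  have hm : 0 < min 1 K₀ := lt_min one_pos hK₀
  refine ⟨min 1 K₀ * (v / V) ^ p, by positivity, fun a u ha hu => ?_⟩
  rcases le_total V u with h1 | h1
  · refine le_trans ?_ (h a u ha ((le_max_left _ _).trans h1))
    gcongr
    calc _ ≤ K₀ * 1 := mul_le_mul' (min_le_right _ _) hvV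
      _ = K₀ := mul_one _
  rcases le_total (a * u) V with h2 | h2
  · have h3 : v / V * a ≤ 1 := by
      rw [div_mul_eq_mul_div]
      refine div_le_one_of_le₀ (le_trans ?_ h2) zero_le
      rw [mul_comm]
      gcongr
    calc min 1 K₀ * (v / V) ^ p * a ^ p * φ u ≤ 1 * (v / V) ^ p * a ^ p * φ u := by
          gcongr; exact min_le_left _ _
      _ = (v / V * a) ^ p * φ u := by rw [one_mul, NNReal.mul_rpow]
      _ ≤ 1 * φ u := by gcongr; exact NNReal.rpow_le_one h3 hp.le
      _ = φ u := one_mul _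
      _ ≤ _ := φ.strictMono.monotone (le_mul_of_one_le_left zero_le ha)
  · have h3 := h (a * u / V) V ((one_le_div₀ hV).2 h2) (le_max_left _ _)
    rw [div_mul_cancel₀ _ hV.ne'] at h3
    refine le_trans ?_ h3
    calc min 1 K₀ * (v / V) ^ p * a ^ p * φ u ≤ K₀ * (v / V) ^ p * a ^ p * φ V := by
          gcongr
          · exact min_le_right _ _
          · exact φ.strictMono.monotone h1
      _ = K₀ * (a * v / V) ^ p * φ V := by
          rw [mul_assoc K₀, ← NNReal.mul_rpow, mul_comm a v, mul_div_right_comm]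
      _ ≤ _ := by gcongr

theorem DeltaTwo.exists_large (h : φ.DeltaTwo .large) {v : ℝ≥0} (hv : 0 < v) :
    ∃ D : ℝ≥0, ∀ u : ℝ≥0, v ≤ u → φ (2 * u) ≤ D * φ u := by
  obtain ⟨D₀, -, v₀, h⟩ := h
  have hφ : φ v ≠ 0 := (φ.pos_of_pos hv).ne'
  refine ⟨D₀ + φ (2 * v₀) / φ v, fun u hu => ?_⟩
  rw [add_mul]
  rcases le_total v₀ u with h1 | h1
  · exact (h u h1).trans le_self_add
  · calc φ (2 * u) ≤ φ (2 * v₀) := φ.strictMono.monotone (by gcongr)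
      _ = φ (2 * v₀) / φ v * φ v := by field_simp
      _ ≤ φ (2 * v₀) / φ v * φ u := by gcongr; exact φ.strictMono.monotone hu
      _ ≤ _ := le_add_self

theorem DeltaStar.exists_small (h : φ.DeltaStar p .small) (hp : 0 < p) {v : ℝ≥0} (hv : 0 < v) :
    ∃ K : ℝ≥0, 0 < K ∧ ∀ a u : ℝ≥0, 1 ≤ a → a * u ≤ v → K * a ^ p * φ u ≤ φ (a * u) := by
  obtain ⟨K₀, hK₀, v₀, hv₀, h⟩ := h
  set w := min v₀ v
  have hw : 0 < w := lt_min hv₀ hv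
  have hwv : (w / v) ^ p ≤ 1 :=
    NNReal.rpow_le_one (div_le_one_of_le₀ (min_le_right _ _) zero_le) hp.le
  have hm : 0 < min 1 K₀ := lt_min one_pos hK₀
  refine ⟨min 1 K₀ * (w / v) ^ p, by positivity, fun a u ha hau => ?_⟩
  rcases le_total (a * u) w with h1 | h1
  · refine le_trans ?_ (h a u ha (h1.trans (min_le_left _ _)))
    gcongr
    calc _ ≤ K₀ * 1 := mul_le_mul' (min_le_right _ _) hwv
      _ = K₀ := mul_one _
  rcases le_total w u with h2 | h2
  · have h3 : w / v * a ≤ 1 := by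
      rw [div_mul_eq_mul_div]
      refine div_le_one_of_le₀ (le_trans ?_ hau) zero_le
      rw [mul_comm]
      gcongr
    calc min 1 K₀ * (w / v) ^ p * a ^ p * φ u ≤ 1 * (w / v) ^ p * a ^ p * φ u := by
          gcongr; exact min_le_left _ _
      _ = (w / v * a) ^ p * φ u := by rw [one_mul, NNReal.mul_rpow]
      _ ≤ 1 * φ u := by gcongr; exact NNReal.rpow_le_one h3 hp.le
      _ = φ u := one_mul _
      _ ≤ _ := φ.strictMono.monotone (le_mul_of_one_le_left zero_le ha)
  · rcases eq_or_ne u 0 with rfl | hu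
    · simp [φ.map_zero]
    have h3 := h (w / u) u ((one_le_div₀ hu.bot_lt).2 h2)
      (by rw [div_mul_cancel₀ _ hu]; exact min_le_left _ _)
    rw [div_mul_cancel₀ _ hu] at h3
    have h4 : w / v * a ≤ w / u := by
      rw [div_mul_eq_mul_div, div_le_div_iff₀ hv hu.bot_lt]
      calc w * a * u = w * (a * u) := mul_assoc _ _ _
        _ ≤ _ := by gcongr
    calc min 1 K₀ * (w / v) ^ p * a ^ p * φ u ≤ K₀ * (w / v) ^ p * a ^ p * φ u := by
          gcongr; exact min_le_right _ _
      _ = K₀ * (w / v * a) ^ p * φ u := by rw [mul_assoc K₀, ← NNReal.mul_rpow]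
      _ ≤ K₀ * (w / u) ^ p * φ u := by gcongr
      _ ≤ φ w := h3
      _ ≤ _ := φ.strictMono.monotone h1

theorem DeltaTwo.exists_small (h : φ.DeltaTwo .small) (v : ℝ≥0) :
    ∃ D : ℝ≥0, ∀ u : ℝ≥0, u ≤ v → φ (2 * u) ≤ D * φ u := by
  obtain ⟨D₀, -, v₀, hv₀, h⟩ := h
  have hφ : φ v₀ ≠ 0 := (φ.pos_of_pos hv₀).ne'
  refine ⟨D₀ + φ (2 * v) / φ v₀, fun u hu => ?_⟩
  rw [add_mul]
  rcases le_total u v₀ with h1 | h1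
  · exact (h u h1).trans le_self_add
  · calc φ (2 * u) ≤ φ (2 * v) := φ.strictMono.monotone (by gcongr)
      _ = φ (2 * v) / φ v₀ * φ v₀ := by field_simp
      _ ≤ φ (2 * v) / φ v₀ * φ u := by gcongr; exact φ.strictMono.monotone h1
      _ ≤ _ := le_add_self

/-- `φ` with a power function substituted for it on `[0, v)`. -/
noncomputable def powBelow (φ : OrliczFunction) (p : ℝ) (v u : ℝ≥0) : ℝ≥0 :=
  if v ≤ u then φ u else φ v * (u / v) ^ p

/-- `φ` with a power function substituted for it on `(v, ∞)`. -/
noncomputable def powAbove (φ : OrliczFunction) (p : ℝ) (v u : ℝ≥0) : ℝ≥0 :=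
  if u ≤ v then φ u else φ v * (u / v) ^ p

theorem powBelow_of_le {v u : ℝ≥0} (h : v ≤ u) : φ.powBelow p v u = φ u := if_pos h

theorem powBelow_of_lt {v u : ℝ≥0} (h : u < v) : φ.powBelow p v u = φ v * (u / v) ^ p :=
  if_neg h.not_ge

theorem powAbove_of_le {v u : ℝ≥0} (h : u ≤ v) : φ.powAbove p v u = φ u := if_pos h

theorem powAbove_of_lt {v u : ℝ≥0} (h : v < u) : φ.powAbove p v u = φ v * (u / v) ^ p :=
  if_neg h.not_ge

theorem mul_div_rpow_le {v u : ℝ≥0} (hp : 0 < p) (h : u ≤ v) : φ v * (u / v) ^ p ≤ φ v :=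
  mul_le_of_le_one_right' (NNReal.rpow_le_one (div_le_one_of_le₀ h zero_le) hp.le)

theorem monotone_powBelow (φ : OrliczFunction) (hp : 0 < p) (v : ℝ≥0) :
    Monotone (φ.powBelow p v) := by
  intro x y hxy
  rcases le_or_gt v x with h1 | h1
  · rw [powBelow_of_le h1, powBelow_of_le (h1.trans hxy)]
    exact φ.strictMono.monotone hxy
  rcases le_or_gt v y with h2 | h2
  · rw [powBelow_of_lt h1, powBelow_of_le h2]
    exact (mul_div_rpow_le hp h1.le).trans (φ.strictMono.monotone h2)
  · rw [powBelow_of_lt h1, powBelow_of_lt h2]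
    gcongr

theorem monotone_powAbove (φ : OrliczFunction) (hp : 0 < p) {v : ℝ≥0} (hv : 0 < v) :
    Monotone (φ.powAbove p v) := by
  intro x y hxy
  rcases le_or_gt y v with h1 | h1
  · rw [powAbove_of_le h1, powAbove_of_le (hxy.trans h1)]
    exact φ.strictMono.monotone hxy
  rcases le_or_gt x v with h2 | h2
  · rw [powAbove_of_le h2, powAbove_of_lt h1]
    exact (φ.strictMono.monotone h2).trans
      (le_mul_of_one_le_right zero_le (NNReal.one_le_rpow ((one_le_div₀ hv).2 h1.le) hp.le))
  · rw [powAbove_of_lt h1, powAbove_of_lt h2]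
    gcongr

/-- The power piece grows exactly like `a ^ p`. Across the junction, growth is exact up to `v`, and
the hypothesis takes over with ratio `a * u / v`. -/
theorem powBelow_growth {v K : ℝ≥0} (hv : 0 < v)
    (h : ∀ a u : ℝ≥0, 1 ≤ a → v ≤ u → K * a ^ p * φ u ≤ φ (a * u)) (a u : ℝ≥0) (ha : 1 ≤ a) :
    min 1 K * a ^ p * φ.powBelow p v u ≤ φ.powBelow p v (a * u) := by
  have hau : u ≤ a * u := le_mul_of_one_le_left zero_le ha
  rcases le_or_gt v u with h1 | h1
  · rw [powBelow_of_le h1, powBelow_of_le (h1.trans hau)]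
    refine le_trans ?_ (h a u ha h1)
    gcongr
    exact min_le_right _ _
  rcases le_or_gt v (a * u) with h2 | h2
  · rw [powBelow_of_lt h1, powBelow_of_le h2]
    have h3 := h (a * u / v) v ((one_le_div₀ hv).2 h2) le_rfl
    rw [div_mul_cancel₀ _ hv.ne'] at h3
    refine le_trans ?_ h3
    rw [mul_div_assoc, NNReal.mul_rpow]
    calc _ ≤ K * a ^ p * (φ v * (u / v) ^ p) := by gcongr; exact min_le_right _ _
      _ = _ := by ring
  · rw [powBelow_of_lt h1, powBelow_of_lt h2, mul_div_assoc, NNReal.mul_rpow]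
    calc _ ≤ 1 * a ^ p * (φ v * (u / v) ^ p) := by gcongr; exact min_le_left _ _
      _ = _ := by ring

theorem powAbove_growth {v K : ℝ≥0} (hv : 0 < v)
    (h : ∀ a u : ℝ≥0, 1 ≤ a → a * u ≤ v → K * a ^ p * φ u ≤ φ (a * u)) (a u : ℝ≥0) (ha : 1 ≤ a) :
    min 1 K * a ^ p * φ.powAbove p v u ≤ φ.powAbove p v (a * u) := by
  have hau : u ≤ a * u := le_mul_of_one_le_left zero_le ha
  rcases le_or_gt (a * u) v with h1 | h1
  · rw [powAbove_of_le h1, powAbove_of_le (hau.trans h1)]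
    refine le_trans ?_ (h a u ha h1)
    gcongr
    exact min_le_right _ _
  rcases le_or_gt u v with h2 | h2
  · rw [powAbove_of_le h2, powAbove_of_lt h1]
    rcases eq_or_ne u 0 with rfl | hu
    · simp [φ.map_zero]
    have h3 := h (v / u) u ((one_le_div₀ hu.bot_lt).2 h2) (by rw [div_mul_cancel₀ _ hu])
    rw [div_mul_cancel₀ _ hu] at h3
    have e : (v / u) ^ p * (a * u / v) ^ p = a ^ p := by
      rw [← NNReal.mul_rpow]
      congr 1
      field_simp
    calc min 1 K * a ^ p * φ u ≤ K * a ^ p * φ u := by gcongr; exact min_le_right _ _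
      _ = (K * (v / u) ^ p * φ u) * (a * u / v) ^ p := by rw [← e]; ring
      _ ≤ _ := by gcongr
  · rw [powAbove_of_lt h1, powAbove_of_lt h2, mul_div_assoc, NNReal.mul_rpow]
    calc _ ≤ 1 * a ^ p * (φ v * (u / v) ^ p) := by gcongr; exact min_le_left _ _
      _ = _ := by ring

theorem powBelow_doubling (hp : 0 < p) {v D : ℝ≥0} (hv : 0 < v)
    (h : ∀ u : ℝ≥0, v ≤ u → φ (2 * u) ≤ D * φ u) (u : ℝ≥0) :
    φ.powBelow p v (2 * u) ≤ 2 ^ p * (1 + D) * φ.powBelow p v u := by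
  have h2p : (1 : ℝ≥0) ≤ 2 ^ p := NNReal.one_le_rpow one_le_two hp.le
  have hu : u ≤ 2 * u := le_mul_of_one_le_left zero_le one_le_two
  rcases le_or_gt v u with h1 | h1
  · rw [powBelow_of_le h1, powBelow_of_le (h1.trans hu)]
    refine (h u h1).trans ?_
    gcongr
    calc D ≤ 1 * (1 + D) := by rw [one_mul]; exact le_add_self
      _ ≤ _ := by gcongr
  rcases le_or_gt v (2 * u) with h2 | h2
  · rw [powBelow_of_lt h1, powBelow_of_le h2]
    have h3 : 1 ≤ 2 ^ p * (u / v) ^ p := by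
      rw [← NNReal.mul_rpow, ← mul_div_assoc]
      exact NNReal.one_le_rpow ((one_le_div₀ hv).2 h2) hp.le
    calc φ (2 * u) ≤ φ (2 * v) := φ.strictMono.monotone (by gcongr)
      _ ≤ D * φ v * 1 := by rw [mul_one]; exact h v le_rfl
      _ ≤ (1 + D) * φ v * (2 ^ p * (u / v) ^ p) := by gcongr; exact le_add_self
      _ = _ := by ring
  · rw [powBelow_of_lt h1, powBelow_of_lt h2, mul_div_assoc, NNReal.mul_rpow]
    calc φ v * (2 ^ p * (u / v) ^ p) = 2 ^ p * 1 * (φ v * (u / v) ^ p) := by ring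
      _ ≤ _ := by gcongr; exact le_self_add

theorem powAbove_doubling (hp : 0 < p) {v D : ℝ≥0}
    (h : ∀ u : ℝ≥0, u ≤ v → φ (2 * u) ≤ D * φ u) (u : ℝ≥0) :
    φ.powAbove p v (2 * u) ≤ 2 ^ p * (1 + D) * φ.powAbove p v u := by
  have h2p : (1 : ℝ≥0) ≤ 2 ^ p := NNReal.one_le_rpow one_le_two hp.le
  have hu : u ≤ 2 * u := le_mul_of_one_le_left zero_le one_le_two
  rcases le_or_gt (2 * u) v with h1 | h1
  · rw [powAbove_of_le h1, powAbove_of_le (hu.trans h1)]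
    refine (h u (hu.trans h1)).trans ?_
    gcongr
    calc D ≤ 1 * (1 + D) := by rw [one_mul]; exact le_add_self
      _ ≤ _ := by gcongr
  rcases le_or_gt u v with h2 | h2
  · rw [powAbove_of_le h2, powAbove_of_lt h1, mul_div_assoc, NNReal.mul_rpow]
    have h3 : (u / v) ^ p ≤ 1 := NNReal.rpow_le_one (div_le_one_of_le₀ h2 zero_le) hp.le
    calc φ v * (2 ^ p * (u / v) ^ p) ≤ φ (2 * u) * (2 ^ p * 1) := by
          gcongr; exact φ.strictMono.monotone h1.le
      _ ≤ (D * φ u) * (2 ^ p * 1) := by gcongr; exact h u h2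
      _ = 2 ^ p * D * φ u := by ring
      _ ≤ _ := by gcongr; exact le_add_self
  · rw [powAbove_of_lt h1, powAbove_of_lt h2, mul_div_assoc, NNReal.mul_rpow]
    calc φ v * (2 ^ p * (u / v) ^ p) = 2 ^ p * 1 * (φ v * (u / v) ^ p) := by ring
      _ ≤ _ := by gcongr; exact le_self_add

/-! ### Sufficiency in the three cases. -/

theorem hasRademacherType_of_all (hp : 0 < p) (hp2 : p ≤ 2) (hD : φ.DeltaTwo .all)
    (hs : φ.DeltaStar p .all) : HasRademacherType (φ.quasiNorm (μ := μ)) p := by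
  obtain ⟨D, -, hD⟩ := hD
  obtain ⟨K, hK, hs⟩ := hs
  exact φ.hasRademacherType_of_hasModularType hp
    (hasModularType_of_growth φ.strictMono.monotone φ.map_zero hK hp hp2 hs hD)

theorem hasRademacherType_of_large [IsFiniteMeasure μ] (hp : 0 < p) (hp2 : p ≤ 2)
    (hD : φ.DeltaTwo .large) (hs : φ.DeltaStar p .large) :
    HasRademacherType (φ.quasiNorm (μ := μ)) p := by
  -- The measure being finite, a small `v` makes the arguments below `v` contribute at most `1/2` to
  -- either modular.
  obtain ⟨v, hv, hvM⟩ : ∃ v : ℝ≥0, 0 < v ∧ (φ v : ℝ≥0∞) * μ Set.univ ≤ (1 / 2 : ℝ≥0) := by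
    have hlim : Tendsto (fun v => φ v * (μ Set.univ).toNNReal) (nhdsWithin 0 (Set.Ioi 0))
        (nhds (φ 0 * (μ Set.univ).toNNReal)) :=
      ((φ.continuous.mul continuous_const).tendsto 0).mono_left nhdsWithin_le_nhds
    rw [φ.map_zero, zero_mul] at hlim
    obtain ⟨v, hv1, hv2⟩ := ((hlim.eventually_le_const (u := (1 / 2 : ℝ≥0)) (by norm_num)).and
      self_mem_nhdsWithin).exists
    refine ⟨v, hv2, ?_⟩
    rw [← ENNReal.coe_toNNReal (measure_ne_top μ Set.univ)]
    exact_mod_cast hv1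
  obtain ⟨D, hD⟩ := hD.exists_large hv
  obtain ⟨K, hK, hs⟩ := hs.exists_large hp hv
  have hK' : 0 < min 1 K := lt_min one_pos hK
  have hgrowth := powBelow_growth hv hs
  have hmod : HasModularType (φ.powBelow p v) μ p :=
    hasModularType_of_growth (φ.monotone_powBelow hp v)
      (by rw [powBelow_of_lt hv, zero_div, NNReal.zero_rpow hp.ne', mul_zero]) hK' hp hp2
      hgrowth (powBelow_doubling hp hv hD)
  -- Division by `A` at least halves the modular of `powBelow`. One direction reduces `1/2 + 1 ≤ 2`
  -- to `1`; the other reduces `1` to `1/2`, leaving room for the error `1/2`.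
  set A : ℝ≥0 := (1 + 2 / min 1 K) ^ (1 / p)
  have hA1 : 1 ≤ A := NNReal.one_le_rpow le_self_add (by positivity)
  have hAp : 2 ≤ min 1 K * A ^ p := by
    rw [← NNReal.rpow_mul, one_div_mul_cancel hp.ne', NNReal.rpow_one]
    calc (2 : ℝ≥0) = min 1 K * (2 / min 1 K) := by field_simp
      _ ≤ _ := by gcongr; exact le_add_self
  have hA0 : 0 < A := one_pos.trans_le hA1
  refine φ.hasRademacherType_of_hasModularType hp (hmod.of_equivalent hA0 hA0 ?_ ?_)
  · intro g hg hI
    refine lintegral_div_le_one (I := 2) hK' hgrowth ?_ hA1 hAp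
    calc ∫⁻ t, (φ.powBelow p v (g t) : ℝ≥0∞) ∂μ ≤ ∫⁻ t, ((φ v : ℝ≥0∞) + φ (g t)) ∂μ := by
          refine lintegral_mono fun t => ?_
          have : φ.powBelow p v (g t) ≤ φ v + φ (g t) := by
            rcases le_or_gt v (g t) with h1 | h1
            · rw [powBelow_of_le h1]; exact le_add_self
            · rw [powBelow_of_lt h1]; exact (mul_div_rpow_le hp h1.le).trans le_self_add
          rw [← ENNReal.coe_add]
          exact ENNReal.coe_le_coe.2 this
      _ ≤ (1 / 2 : ℝ≥0) + 1 := by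
          rw [lintegral_add_left measurable_const, lintegral_const]
          exact add_le_add hvM hI
      _ ≤ _ := by
          have : (1 / 2 : ℝ≥0) + 1 ≤ 2 := by rw [← NNReal.coe_le_coe]; push_cast; norm_num
          exact_mod_cast this
  · intro g hg hI
    have h1 := lintegral_div_le (I := 1) (J := 1 / 2) hK' hgrowth (by simpa using hI) hA1
      (by
        calc (1 : ℝ≥0) = 2 * (1 / 2) := by field_simp
          _ ≤ _ := by gcongr)
    calc ∫⁻ t, (φ (g t / A) : ℝ≥0∞) ∂μ ≤
          ∫⁻ t, ((φ v : ℝ≥0∞) + φ.powBelow p v (g t / A)) ∂μ := by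
          refine lintegral_mono fun t => ?_
          have : φ (g t / A) ≤ φ v + φ.powBelow p v (g t / A) := by
            rcases le_or_gt v (g t / A) with h1 | h1
            · rw [powBelow_of_le h1]; exact le_add_self
            · exact (φ.strictMono.monotone h1.le).trans le_self_add
          rw [← ENNReal.coe_add]
          exact ENNReal.coe_le_coe.2 this
      _ ≤ (1 / 2 : ℝ≥0) + (1 / 2 : ℝ≥0) := by
          rw [lintegral_add_left measurable_const, lintegral_const]
          exact add_le_add hvM h1
      _ = 1 := by
          have : (1 / 2 : ℝ≥0) + (1 / 2 : ℝ≥0) = 1 := by norm_num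
          exact_mod_cast this

/-- For the counting measure a modular at most `1` bounds every single term. With `φ v ≥ 1` this
keeps all values at most `v`, where `φ` and `powAbove` agree, so the unit balls coincide. -/
theorem hasRademacherType_of_small (hp : 0 < p) (hp2 : p ≤ 2) (hD : φ.DeltaTwo .small)
    (hs : φ.DeltaStar p .small) :
    HasRademacherType (φ.quasiNorm (μ := (Measure.count : Measure ℕ))) p := by
  obtain ⟨v, hv1, hv⟩ : ∃ v : ℝ≥0, 1 ≤ φ v ∧ 0 < v :=
    ((φ.tendsto_atTop.eventually_ge_atTop 1).and (eventually_gt_atTop 0)).exists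
  obtain ⟨D, hD⟩ := hD.exists_small v
  obtain ⟨K, hK, hs⟩ := hs.exists_small hp hv
  have hK' : 0 < min 1 K := lt_min one_pos hK
  have hmod : HasModularType (φ.powAbove p v) (Measure.count : Measure ℕ) p :=
    hasModularType_of_growth (φ.monotone_powAbove hp hv)
      (by rw [powAbove_of_le zero_le, φ.map_zero]) hK' hp hp2
      (powAbove_growth hv hs) (powAbove_doubling hp hD)
  have hle : ∀ (χ : ℝ≥0 → ℝ≥0) (g : ℕ → ℝ≥0),
      ∫⁻ t, (χ (g t) : ℝ≥0∞) ∂Measure.count ≤ 1 → ∀ t, χ (g t) ≤ 1 := by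
    intro χ g hI t
    rw [lintegral_count] at hI
    exact_mod_cast (ENNReal.le_tsum t).trans hI
  refine φ.hasRademacherType_of_hasModularType hp
    (hmod.of_equivalent (A := 1) (B := 1) one_pos one_pos ?_ ?_)
  · intro g hg hI
    refine le_trans (le_of_eq (lintegral_congr fun t => ?_)) hI
    rw [div_one, powAbove_of_le (φ.strictMono.le_iff_le.1 ((hle φ g hI t).trans hv1))]
  · intro g hg hI
    refine le_trans (le_of_eq (lintegral_congr fun t => ?_)) hI
    have h1 := hle _ g hI t
    have hgv : g t ≤ v := by
      by_contra! hlt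
      rw [powAbove_of_lt hlt] at h1
      refine h1.not_gt (hv1.trans_lt ?_)
      exact lt_mul_of_one_lt_right (φ.pos_of_pos hv)
        (NNReal.one_lt_rpow ((one_lt_div₀ hv).2 hlt) hp)
    rw [div_one, powAbove_of_le hgv]

end OrliczFunction

/-! ### Non-atomic measures and disjoint sets of equal measure. -/

section Nonatomic

variable {Ω : Type*} [MeasurableSpace Ω] {μ : Measure Ω}

theorem IsNonatomic.exists_measure_le_half (h : IsNonatomic μ) {A : Set Ω} (hA : MeasurableSet A)
    (h0 : 0 < μ A) (hfin : μ A ≠ ∞) :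
    ∃ B ⊆ A, MeasurableSet B ∧ 0 < μ B ∧ μ B ≤ μ A * 2⁻¹ := by
  obtain ⟨B, hB, hBA, hB0, hlt⟩ := h A hA h0
  have hadd : μ B + μ (A \ B) = μ A := by
    rw [← measure_inter_add_sdiff A hB, Set.inter_eq_right.2 hBA]
  rcases le_total (μ B) (μ A * 2⁻¹) with h1 | h1
  · exact ⟨B, hBA, hB, hB0, h1⟩
  · refine ⟨A \ B, Set.sdiff_subset, hA.diff hB, ?_, ?_⟩
    · by_contra! hle
      rw [nonpos_iff_eq_zero.1 hle, add_zero] at hadd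
      exact hlt.ne hadd
    · have h2 : μ A * 2⁻¹ + μ (A \ B) ≤ μ A * 2⁻¹ + μ A * 2⁻¹ := by
        rw [← mul_add, ENNReal.inv_two_add_inv_two, mul_one, ← hadd]
        exact add_le_add (hadd ▸ h1) le_rfl
      exact (ENNReal.add_le_add_iff_left (ENNReal.mul_ne_top hfin (by simp))).1 h2

theorem IsNonatomic.exists_measure_le (h : IsNonatomic μ) {A : Set Ω} (hA : MeasurableSet A)
    (h0 : 0 < μ A) (hfin : μ A ≠ ∞) {ε : ℝ≥0∞} (hε : 0 < ε) :
    ∃ B ⊆ A, MeasurableSet B ∧ 0 < μ B ∧ μ B ≤ ε := by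
  have hiter : ∀ n : ℕ, ∃ B ⊆ A, MeasurableSet B ∧ 0 < μ B ∧ μ B ≤ μ A * 2⁻¹ ^ n := by
    intro n
    induction n with
    | zero => exact ⟨A, subset_rfl, hA, h0, by simp⟩
    | succ n ih =>
      obtain ⟨B, hBA, hB, hB0, hle⟩ := ih
      obtain ⟨C, hCB, hC, hC0, hCle⟩ :=
        h.exists_measure_le_half hB hB0 (measure_ne_top_of_subset hBA hfin)
      refine ⟨C, hCB.trans hBA, hC, hC0, hCle.trans ?_⟩
      rw [pow_succ, ← mul_assoc]
      gcongr
  obtain ⟨n, hn⟩ := ENNReal.exists_inv_two_pow_lt (ENNReal.div_pos hε.ne' hfin).ne'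
  obtain ⟨B, hBA, hB, hB0, hle⟩ := hiter n
  refine ⟨B, hBA, hB, hB0, hle.trans ?_⟩
  calc μ A * 2⁻¹ ^ n ≤ μ A * (ε / μ A) := by gcongr
    _ ≤ ε := ENNReal.mul_div_le

/-- The greedy step of Sierpiński's theorem: the supremum of admissible measures need not be
attained, but half of it is, and this is enough. -/
theorem exists_almost_largest_subset {A B : Set Ω} (hfin : μ A ≠ ∞) {t : ℝ≥0∞} (hBt : μ B ≤ t) :
    ∃ C ⊆ A \ B, MeasurableSet C ∧ μ B + μ C ≤ t ∧
      ∀ D ⊆ A \ B, MeasurableSet D → μ B + μ D ≤ t → μ D ≤ 2 * μ C := by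
  set s : ℝ≥0∞ := ⨆ D : {D : Set Ω // D ⊆ A \ B ∧ MeasurableSet D ∧ μ B + μ D ≤ t}, μ D.1 with hs
  have hle : ∀ D ⊆ A \ B, MeasurableSet D → μ B + μ D ≤ t → μ D ≤ s := fun D h1 h2 h3 =>
    le_iSup (fun D : {D : Set Ω // D ⊆ A \ B ∧ MeasurableSet D ∧ μ B + μ D ≤ t} => μ D.1)
      ⟨D, h1, h2, h3⟩
  rcases eq_or_ne s 0 with h0 | h0
  · refine ⟨∅, Set.empty_subset _, MeasurableSet.empty, by simpa using hBt, fun D h1 h2 h3 => ?_⟩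
    have := hle D h1 h2 h3
    rw [h0] at this
    exact this.trans zero_le
  · have hsfin : s ≠ ∞ :=
      ((iSup_le fun D => measure_mono (D.2.1.trans Set.sdiff_subset)).trans_lt hfin.lt_top).ne
    obtain ⟨⟨C, h1, h2, h3⟩, hC⟩ := lt_iSup_iff.1 (ENNReal.half_lt_self h0 hsfin)
    refine ⟨C, h1, h2, h3, fun D h4 h5 h6 => (hle D h4 h5 h6).trans ?_⟩
    rw [mul_comm]
    exact (ENNReal.div_le_iff (by simp) (by simp)).1 hC.le

/-- Sierpiński's theorem: a non-atomic measure takes every value below a finite value. -/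
theorem IsNonatomic.exists_subset_measure_eq (h : IsNonatomic μ) {A : Set Ω} (hA : MeasurableSet A)
    (hfin : μ A ≠ ∞) {t : ℝ≥0∞} (ht : t ≤ μ A) : ∃ B ⊆ A, MeasurableSet B ∧ μ B = t := by
  have htfin : t ≠ ∞ := (ht.trans_lt hfin.lt_top).ne
  choose! C hCsub hCm hCt hCmax using
    fun (B : Set Ω) (hBt : μ B ≤ t) => exists_almost_largest_subset (A := A) (B := B) hfin hBt
  let B : ℕ → Set Ω := fun n => Nat.rec ∅ (fun _ B => B ∪ C B) n
  have hBs : ∀ n, B (n + 1) = B n ∪ C (B n) := fun n => rfl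
  have hadd : ∀ n, μ (B n) ≤ t → μ (B (n + 1)) = μ (B n) + μ (C (B n)) := fun n hn => by
    rw [hBs]
    exact measure_union (Set.disjoint_sdiff_right.mono_right (hCsub _ hn)) (hCm _ hn)
  have hB : ∀ n, B n ⊆ A ∧ MeasurableSet (B n) ∧ μ (B n) ≤ t := by
    intro n
    induction n with
    | zero => exact ⟨Set.empty_subset _, MeasurableSet.empty, by simp [B]⟩
    | succ n ih =>
      obtain ⟨h1, h2, h3⟩ := ih
      refine ⟨?_, ?_, ?_⟩
      · rw [hBs]
        exact Set.union_subset h1 ((hCsub _ h3).trans Set.sdiff_subset)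
      · rw [hBs]
        exact h2.union (hCm _ h3)
      · rw [hadd n h3]
        exact hCt _ h3
  have hmono : Monotone B := monotone_nat_of_le_succ fun n => Set.subset_union_left
  have hU : MeasurableSet (⋃ n, B n) := MeasurableSet.iUnion fun n => (hB n).2.1
  have hUA : ⋃ n, B n ⊆ A := Set.iUnion_subset fun n => (hB n).1
  have hUt : μ (⋃ n, B n) ≤ t := by
    rw [hmono.measure_iUnion]
    exact iSup_le fun n => (hB n).2.2
  refine ⟨⋃ n, B n, hUA, hU, hUt.antisymm ?_⟩
  by_contra! hlt
  have hpos : 0 < μ (A \ ⋃ n, B n) := by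
    rw [measure_sdiff hUA hU.nullMeasurableSet (measure_ne_top_of_subset hUA hfin)]
    exact tsub_pos_of_lt (hlt.trans_le ht)
  obtain ⟨D, hDA, hD, hD0, hDle⟩ := h.exists_measure_le (hA.diff hU) hpos
    (measure_ne_top_of_subset Set.sdiff_subset hfin) (tsub_pos_of_lt hlt)
  -- The set `D` remains admissible at every stage, so each greedy step adds at least half its
  -- measure; the total would then exceed `t`.
  have hgrow : ∀ n : ℕ, n * μ D ≤ 2 * μ (B n) := by
    intro n
    induction n with
    | zero => simp
    | succ n ih =>
      have hsub : B n ⊆ ⋃ n, B n := Set.subset_iUnion B n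
      have h1 := hCmax (B n) (hB n).2.2 D (hDA.trans (Set.sdiff_subset_sdiff_right hsub)) hD (by
        calc μ (B n) + μ D ≤ μ (⋃ n, B n) + (t - μ (⋃ n, B n)) :=
              add_le_add (measure_mono hsub) hDle
          _ = t := add_tsub_cancel_of_le hUt)
      rw [hadd n (hB n).2.2, mul_add]
      push_cast
      rw [add_mul, one_mul]
      exact add_le_add ih h1
  obtain ⟨n, hn⟩ := ENNReal.exists_nat_mul_gt hD0.ne' (ENNReal.mul_ne_top (by simp : (2 : ℝ≥0∞) ≠ ∞) htfin)
  refine hn.not_ge ((hgrow n).trans ?_)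
  gcongr
  exact (hB n).2.2

/-- There are `N` disjoint sets of the same measure and of total measure between `x / 2` and `x`. -/
def HasDisjointFamily (μ : Measure Ω) (N : ℕ) (x : ℝ≥0) : Prop :=
  ∃ (A : Fin N → Set Ω) (t : ℝ≥0), (∀ i, MeasurableSet (A i)) ∧
    Pairwise (Function.onFun Disjoint A) ∧ (∀ i, μ (A i) = t) ∧ x ≤ 2 * (N * t) ∧ N * t ≤ x

theorem IsNonatomic.exists_disjoint_subsets (h : IsNonatomic μ) (t : ℝ≥0) (N : ℕ) :
    ∀ E : Set Ω, MeasurableSet E → μ E = N * t → ∃ A : Fin N → Set Ω, (∀ i, A i ⊆ E) ∧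
      (∀ i, MeasurableSet (A i)) ∧ Pairwise (Function.onFun Disjoint A) ∧ ∀ i, μ (A i) = t := by
  induction N with
  | zero =>
    exact fun E _ _ => ⟨fun _ => ∅, fun i => i.elim0, fun i => i.elim0, fun i => i.elim0,
      fun i => i.elim0⟩
  | succ N ih =>
    intro E hE hEt
    push_cast at hEt
    rw [add_mul, one_mul] at hEt
    have hfin : μ E ≠ ∞ := by
      rw [hEt]
      exact ENNReal.add_ne_top.2 ⟨ENNReal.mul_ne_top (by simp) (by simp), by simp⟩
    obtain ⟨B, hBE, hB, hBt⟩ := h.exists_subset_measure_eq hE hfin (t := t)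
      (by rw [hEt]; exact le_add_self)
    obtain ⟨A, hAE, hA, hd, hAt⟩ := ih (E \ B) (hE.diff hB) (by
      rw [measure_sdiff hBE hB.nullMeasurableSet (measure_ne_top_of_subset hBE hfin), hEt, hBt]
      exact ENNReal.add_sub_cancel_right (by simp))
    have hBA : ∀ i, Disjoint B (A i) := fun i => Set.disjoint_sdiff_right.mono_right (hAE i)
    refine ⟨Fin.cons B A, ?_, ?_, ?_, ?_⟩
    · exact Fin.cases hBE fun i => (hAE i).trans Set.sdiff_subset
    · exact Fin.cases hB hA
    · intro i j
      refine Fin.cases ?_ (fun i => ?_) i <;> refine Fin.cases ?_ (fun j => ?_) j <;> intro hij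
      · exact absurd rfl hij
      · exact hBA j
      · exact (hBA i).symm
      · exact hd fun e => hij (congrArg Fin.succ e)
    · exact Fin.cases hBt hAt

theorem IsNonatomic.hasDisjointFamily (h : IsNonatomic μ) {E : Set Ω} (hE : MeasurableSet E)
    (hfin : μ E ≠ ∞) {x : ℝ≥0} (hx : x ≤ μ E) {N : ℕ} (hN : 0 < N) : HasDisjointFamily μ N x := by
  obtain ⟨F, -, hF, hFx⟩ := h.exists_subset_measure_eq hE hfin hx
  have hN' : (N : ℝ≥0) ≠ 0 := by exact_mod_cast hN.ne'
  have hxN : (N : ℝ≥0) * (x / N) = x := mul_div_cancel₀ _ hN'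
  obtain ⟨A, -, hA, hd, hAt⟩ := h.exists_disjoint_subsets (x / N) N F hF
    (by rw [hFx]; exact_mod_cast hxN.symm)
  refine ⟨A, x / N, hA, hd, hAt, ?_, hxN.le⟩
  rw [hxN]
  exact le_mul_of_one_le_left zero_le one_le_two

theorem hasDisjointFamily_of_measure_univ_eq_top [SigmaFinite μ] (h : IsNonatomic μ)
    (hμ : μ Set.univ = ∞) (x : ℝ≥0) {N : ℕ} (hN : 0 < N) : HasDisjointFamily μ N x := by
  obtain ⟨E, hE, -, hxE, hfin⟩ := Measure.exists_subset_measure_lt_top (μ := μ)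
    MeasurableSet.univ (r := x) (by rw [hμ]; exact ENNReal.coe_lt_top)
  exact h.hasDisjointFamily hE hfin.ne hxE.le hN

/-- The sets are consecutive blocks of `⌊x / N⌋` integers. Rounding down a number that is at least
`1` loses at most a factor `2`, which explains the slack in `HasDisjointFamily`. -/
theorem hasDisjointFamily_count {x : ℝ≥0} {N : ℕ} (hN : 0 < N) (hx : N ≤ x) :
    HasDisjointFamily (Measure.count : Measure ℕ) N x := by
  have hN' : (0 : ℝ≥0) < N := by exact_mod_cast hN
  set m := ⌊x / N⌋₊ with hm
  have h1 : 1 ≤ m := Nat.le_floor (by simpa using (one_le_div₀ hN').2 hx)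
  refine ⟨fun i => ((Finset.Ico (i * m) ((i + 1) * m) : Finset ℕ) : Set ℕ), m,
    fun i => Finset.measurableSet _, ?_, fun i => ?_, ?_, ?_⟩
  · intro i j hij
    have key : ∀ i j : Fin N, i < j → Disjoint (Finset.Ico (i * m) ((i + 1) * m))
        (Finset.Ico (j * m) ((j + 1) * m)) := by
      intro i j hij
      refine Finset.disjoint_left.2 fun a ha hb => ?_
      have h2 : ((i : ℕ) + 1) * m ≤ j * m := Nat.mul_le_mul_right _ hij
      exact ((Finset.mem_Ico.1 ha).2.trans_le h2).not_ge (Finset.mem_Ico.1 hb).1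
    rcases lt_or_gt_of_ne hij with h | h
    · exact Finset.disjoint_coe.2 (key i j h)
    · exact (Finset.disjoint_coe.2 (key j i h)).symm
  · rw [Measure.count_apply_finset, Nat.card_Ico, add_mul, one_mul, Nat.add_sub_cancel_left]
    simp
  · have h2 : x / N < m + 1 := Nat.lt_floor_add_one _
    rw [div_lt_iff₀ hN'] at h2
    have h3 : (1 : ℝ≥0) ≤ m := by exact_mod_cast h1
    calc x ≤ (m + 1) * N := h2.le
      _ ≤ (m + m) * N := by gcongr
      _ = _ := by ring
  · have h2 : (m : ℝ≥0) ≤ x / N := Nat.floor_le zero_le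
    rwa [le_div_iff₀ hN', mul_comm] at h2

end Nonatomic

/-! ### Necessity: testing type on step functions. -/

namespace OrliczFunction

variable {Ω : Type*} [MeasurableSpace Ω] {μ : Measure Ω} {φ : OrliczFunction} {p : ℝ}

theorem lintegral_indicator_sum {N : ℕ} {A : Fin N → Set Ω} {t : ℝ≥0}
    (hA : ∀ i, MeasurableSet (A i)) (hd : Pairwise (Function.onFun Disjoint A))
    (ht : ∀ i, μ (A i) = t) (c : Fin N → ℝ) (d : ℝ≥0) :
    ∫⁻ ω, (φ (‖∑ i, c i * (A i).indicator (fun _ => (1 : ℝ)) ω‖₊ / d) : ℝ≥0∞) ∂μ =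
      ((∑ i, φ (‖c i‖₊ / d) * t : ℝ≥0) : ℝ≥0∞) := by
  have hpt : ∀ ω, (φ (‖∑ i, c i * (A i).indicator (fun _ => (1 : ℝ)) ω‖₊ / d) : ℝ≥0∞) =
      ∑ i, (A i).indicator (fun _ => (φ (‖c i‖₊ / d) : ℝ≥0∞)) ω := by
    intro ω
    by_cases h : ∃ j, ω ∈ A j
    · obtain ⟨j, hj⟩ := h
      have hne : ∀ i, i ≠ j → ω ∉ A i := fun i hij hi => Set.disjoint_left.1 (hd hij) hi hj
      rw [Finset.sum_eq_single j (fun i _ hij => by simp [hne i hij]) (by simp),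
        Finset.sum_eq_single j (fun i _ hij => by simp [hne i hij]) (by simp)]
      simp [hj]
    · push Not at h
      simp [h, φ.map_zero]
  simp only [hpt]
  rw [lintegral_finsetSum _ fun i _ => measurable_const.indicator (hA i)]
  push_cast
  refine Finset.sum_congr rfl fun i _ => ?_
  rw [lintegral_indicator_const (hA i), ht]

theorem exists_stepMap (φ : OrliczFunction) {N : ℕ} {A : Fin N → Set Ω} {t : ℝ≥0}
    (hA : ∀ i, MeasurableSet (A i)) (hd : Pairwise (Function.onFun Disjoint A))
    (ht : ∀ i, μ (A i) = t) : ∃ T : (Fin N → ℝ) →ₗ[ℝ] φ.orliczSpace μ, ∀ (c : Fin N → ℝ) (d : ℝ≥0),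
      ∫⁻ ω, (φ (‖(T c : Ω →ₘ[μ] ℝ) ω‖₊ / d) : ℝ≥0∞) ∂μ =
        ((∑ i, φ (‖c i‖₊ / d) * t : ℝ≥0) : ℝ≥0∞) := by
  have hsm : ∀ i, AEStronglyMeasurable ((A i).indicator fun _ => (1 : ℝ)) μ := fun i =>
    (measurable_const.indicator (hA i)).aestronglyMeasurable
  have hmem : ∀ i, AEEqFun.mk _ (hsm i) ∈ φ.orliczSpace μ := by
    intro i
    refine ⟨1, one_pos, ?_⟩
    rw [one_smul]
    have h := lintegral_indicator_sum (φ := φ) hA hd ht (Pi.single i 1) 1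
    unfold modular
    rw [lintegral_congr_ae (g := fun ω => (φ (‖∑ j, (Pi.single i 1 : Fin N → ℝ) j *
      (A j).indicator (fun _ => (1 : ℝ)) ω‖₊ / 1) : ℝ≥0∞)), h]
    · exact ENNReal.coe_lt_top
    · filter_upwards [AEEqFun.coeFn_mk _ (hsm i)] with ω hω
      rw [hω, div_one, Finset.sum_eq_single i (fun j _ hj => by simp [hj]) (by simp)]
      simp
  refine ⟨Fintype.linearCombination ℝ fun i => ⟨AEEqFun.mk _ (hsm i), hmem i⟩, fun c d => ?_⟩
  rw [← lintegral_indicator_sum (φ := φ) hA hd ht c d]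
  refine lintegral_congr_ae ?_
  have hall : ∀ᵐ ω ∂μ, ∀ i, AEEqFun.mk _ (hsm i) ω = (A i).indicator (fun _ => (1 : ℝ)) ω :=
    ae_all_iff.2 fun i => AEEqFun.coeFn_mk _ (hsm i)
  filter_upwards [hall, φ.coeFn_sum_smul c fun i => ⟨AEEqFun.mk _ (hsm i), hmem i⟩] with ω h1 h2
  rw [Fintype.linearCombination_apply, h2]
  simp only [h1]

/-- The inequality expressing type `p` with constant `K`, as an average over signs. -/
def TypeBound (φ : OrliczFunction) (μ : Measure Ω) (p : ℝ) (K : ℝ≥0) : Prop :=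
  ∀ (n : ℕ) (x : Fin n → φ.orliczSpace μ),
    (1 / 2 ^ n) * ∑ s : Fin n → Bool, φ.quasiNorm (∑ k, boolSign (s k) • x k)
      ≤ K * (∑ k : Fin n, φ.quasiNorm (x k) ^ p) ^ (1 / p)

theorem _root_.HasRademacherType.exists_typeBound
    (h : HasRademacherType (φ.quasiNorm (μ := μ)) p) : ∃ K : ℝ≥0, 0 < K ∧ φ.TypeBound μ p K := by
  obtain ⟨K, hK, h⟩ := (hasRademacherType_iff_sum _ _).1 h
  lift K to ℝ≥0 using hK.le
  exact ⟨K, by exact_mod_cast hK, h⟩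

theorem TypeBound.le_of_bounds {K : ℝ≥0} (h : φ.TypeBound μ p K) (hp : 0 < p) {n : ℕ}
    (x : Fin n → φ.orliczSpace μ) {a b : ℝ≥0} (hx : ∀ k, φ.quasiNorm (x k) ≤ b)
    (ha : ∀ s : Fin n → Bool, a ≤ φ.quasiNorm (∑ k, boolSign (s k) • x k)) :
    a ≤ K * (n : ℝ≥0) ^ (1 / p) * b := by
  rw [← NNReal.coe_le_coe]
  push_cast
  calc (a : ℝ) = (1 / 2 ^ n) * ∑ s : Fin n → Bool, (a : ℝ) := by
        simp
    _ ≤ (1 / 2 ^ n) * ∑ s : Fin n → Bool, φ.quasiNorm (∑ k, boolSign (s k) • x k) := by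
        gcongr with s; exact ha s
    _ ≤ K * (∑ k : Fin n, φ.quasiNorm (x k) ^ p) ^ (1 / p) := h n x
    _ ≤ K * (∑ k : Fin n, (b : ℝ) ^ p) ^ (1 / p) := by
        have hnn := fun k => φ.quasiNorm_nonneg (x k)
        gcongr with k
        · exact Finset.sum_nonneg fun k _ => Real.rpow_nonneg (hnn k) p
        · exact hnn k
        · exact hx k
    _ = _ := by
        rw [Finset.sum_const, Finset.card_univ, Fintype.card_fin, nsmul_eq_mul,
          Real.mul_rpow (by positivity) (by positivity), ← Real.rpow_mul b.coe_nonneg,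
          mul_one_div_cancel hp.ne', Real.rpow_one, mul_assoc]

/-- Test vectors `u 1_{A k}`: every signed sum has modulus `u` on the union, whose measure makes its
quasi-norm at least `1`. Type then prevents the single blocks from being too small, and this lower
bound is the growth of `φ`. -/
theorem TypeBound.growth_of_hasDisjointFamily {K : ℝ≥0} (h : φ.TypeBound μ p K) (hK : 0 < K)
    (hp : 0 < p) {n : ℕ} (hn : 0 < n) {u : ℝ≥0} (hu : 0 < u)
    (hfam : HasDisjointFamily μ n (2 / φ u)) :
    n * φ u ≤ 2 * φ (2 * K * (n : ℝ≥0) ^ (1 / p) * u) := by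
  obtain ⟨A, t, hA, hd, ht, hx1, hx2⟩ := hfam
  have hφ := φ.pos_of_pos hu
  have hn0 : (0 : ℝ≥0) < n := by exact_mod_cast hn
  have hr : 0 < (n : ℝ≥0) ^ (1 / p) := NNReal.rpow_pos hn0
  have hnt : 1 ≤ n * t * φ u := by
    rw [div_le_iff₀ hφ, mul_assoc] at hx1
    exact le_of_mul_le_mul_left (by simpa using hx1) (two_pos : (0 : ℝ≥0) < 2)
  have ht0 : 0 < t := by
    rcases eq_or_ne t 0 with rfl | h0
    · simp at hnt
    · exact h0.bot_lt
  -- If all blocks had quasi-norm at most this `b`, type would give `1 ≤ 1/2`.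
  set b : ℝ≥0 := (2 * K * (n : ℝ≥0) ^ (1 / p))⁻¹ with hb
  have hb0 : 0 < b := by positivity
  have hub : u / b = 2 * K * (n : ℝ≥0) ^ (1 / p) * u := by rw [hb, div_inv_eq_mul, mul_comm]
  obtain ⟨T, hT⟩ := exists_stepMap φ hA hd ht
  have key : 1 < φ (u / b) * t := by
    by_contra! hle
    have h1 := h.le_of_bounds hp (fun k => T (Pi.single k (u : ℝ))) (a := 1) (b := b) ?_ ?_
    · have h2 : K * (n : ℝ≥0) ^ (1 / p) * b = 1 / 2 := by rw [hb]; field_simp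
      rw [h2] at h1
      rw [← NNReal.coe_le_coe] at h1
      push_cast at h1
      norm_num at h1
    · intro k
      refine φ.quasiNorm_le hb0 ?_
      rw [hT, Finset.sum_eq_single k (fun j _ hj => by simp [hj, φ.map_zero]) (by simp)]
      simpa using mod_cast hle
    · intro s
      have e : ∑ k, boolSign (s k) • T (Pi.single k (u : ℝ)) = T fun k => boolSign (s k) * u := by
        simp only [← map_smul, ← map_sum]
        congr 1
        ext j
        simp [Finset.sum_apply, Pi.single_apply]
      rw [e]
      refine φ.le_quasiNorm fun c hc hc1 => ?_
      rw [hT]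
      simp only [nnnorm_mul, nnnorm_boolSign, one_mul, NNReal.nnnorm_eq]
      rw [Finset.sum_const, Finset.card_univ, Fintype.card_fin, nsmul_eq_mul]
      have h3 : φ u < φ (u / c) := φ.strictMono (by
        rw [lt_div_iff₀ hc]; exact mul_lt_of_lt_one_right hu hc1)
      have h4 : 1 < n * (φ (u / c) * t) := by
        calc 1 ≤ n * t * φ u := hnt
          _ < n * t * φ (u / c) := by gcongr
          _ = _ := by ring
      exact_mod_cast h4
  rw [← hub]
  rw [le_div_iff₀ hφ] at hx2
  calc n * φ u = n * φ u * 1 := by rw [mul_one]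
    _ ≤ n * φ u * (φ (u / b) * t) := by gcongr
    _ = (n * t * φ u) * φ (u / b) := by ring
    _ ≤ _ := by gcongr

/-- The sets are indexed by sign vectors, and the `k`-th test function is `u` times the `k`-th sign,
of quasi-norm at most `1`. A signed sum equals `n * u` on the set carrying the same signs. If
doubling failed at `u`, this one set would force quasi-norm at least `n / 2`, too large for type `p`
by the choice of `n`. -/
theorem TypeBound.doubling_of_hasDisjointFamily {K : ℝ≥0} (h : φ.TypeBound μ p K)
    (hp : 0 < p) {n : ℕ} (hn : 2 * K * (n : ℝ≥0) ^ (1 / p) < n) {u : ℝ≥0} (hu : 0 < u)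
    (hfam : HasDisjointFamily μ (2 ^ n) (1 / φ u)) : φ (2 * u) ≤ 2 * 2 ^ n * φ u := by
  obtain ⟨A, t, hA, hd, ht, hx1, hx2⟩ := hfam
  have hφ := φ.pos_of_pos hu
  have hn0 : (0 : ℝ≥0) < n := zero_le.trans_lt hn
  rw [div_le_iff₀ hφ] at hx1
  rw [le_div_iff₀ hφ] at hx2
  push_cast at hx1 hx2
  by_contra! hlt
  have ht0 : 0 < t := by
    rcases eq_or_ne t 0 with rfl | h0
    · simp at hx1
    · exact h0.bot_lt
  have ht2 : 1 < t * φ (2 * u) := by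
    calc 1 ≤ 2 * (2 ^ n * t) * φ u := hx1
      _ = t * (2 * 2 ^ n * φ u) := by ring
      _ < _ := by gcongr
  obtain ⟨T, hT⟩ := exists_stepMap φ hA hd ht
  let e : (Fin n → Bool) ≃ Fin (2 ^ n) := Fintype.equivFinOfCardEq (by simp)
  have h1 := h.le_of_bounds hp (fun k => T fun j => boolSign (e.symm j k) * u)
    (a := n / 2) (b := 1) ?_ ?_
  · rw [mul_one, div_le_iff₀ two_pos] at h1
    refine hn.not_ge (h1.trans (le_of_eq ?_))
    ring
  · intro k
    refine φ.quasiNorm_le one_pos ?_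
    rw [hT]
    simp only [nnnorm_mul, nnnorm_boolSign, one_mul, NNReal.nnnorm_eq, div_one]
    rw [Finset.sum_const, Finset.card_univ, Fintype.card_fin, nsmul_eq_mul]
    have : ((2 ^ n : ℕ) : ℝ≥0) * (φ u * t) ≤ 1 := by
      refine le_trans (le_of_eq ?_) hx2
      push_cast
      ring
    exact_mod_cast this
  · intro s
    have e1 : ∑ k, boolSign (s k) • T (fun j => boolSign (e.symm j k) * u) =
        T fun j => ∑ k, boolSign (s k) * (boolSign (e.symm j k) * u) := by
      simp only [← map_smul, ← map_sum]
      congr 1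
      ext j
      simp [Finset.sum_apply]
    rw [e1]
    refine φ.le_quasiNorm fun c hc hc1 => ?_
    rw [hT]
    have hsq : ∀ b : Bool, boolSign b * boolSign b = 1 := by
      intro b; cases b <;> simp [boolSign]
    have h2 : φ (n * u / c) * t ≤
        ∑ i, φ (‖∑ k, boolSign (s k) * (boolSign (e.symm i k) * (u : ℝ))‖₊ / c) * t := by
      refine le_trans (le_of_eq ?_) (Finset.single_le_sum (fun _ _ => zero_le)
        (Finset.mem_univ (e s)))
      simp [← mul_assoc, hsq]
    have h3 : φ (2 * u) ≤ φ (n * u / c) := by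
      refine φ.strictMono.monotone ?_
      rw [le_div_iff₀ hc]
      calc 2 * u * c ≤ 2 * u * (n / 2) := by gcongr
        _ = n * u := by field_simp
    have h4 : 1 < ∑ i, φ (‖∑ k, boolSign (s k) * (boolSign (e.symm i k) * (u : ℝ))‖₊ / c) * t := by
      calc 1 < t * φ (2 * u) := ht2
        _ ≤ t * φ (n * u / c) := by gcongr
        _ = φ (n * u / c) * t := mul_comm _ _
        _ ≤ _ := h2
    exact_mod_cast h4

/-- The place where `p > 1` enters: `n ^ (1 / p)` is of smaller order than `n`. -/
theorem exists_nat_mul_rpow_lt (L : ℝ≥0) (hp : 1 < p) :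
    ∃ n : ℕ, L * (n : ℝ≥0) ^ (1 / p) < n := by
  have hq : 0 < 1 - 1 / p := by
    rw [sub_pos, div_lt_one (by linarith)]; exact hp
  have hlim : Tendsto (fun n : ℕ => (n : ℝ) ^ (1 - 1 / p)) atTop atTop :=
    (tendsto_rpow_atTop hq).comp tendsto_natCast_atTop_atTop
  obtain ⟨n, hn1, hn2⟩ := ((hlim.eventually_gt_atTop (L : ℝ)).and (eventually_gt_atTop 0)).exists
  have hn0 : (0 : ℝ) < n := by exact_mod_cast hn2
  refine ⟨n, ?_⟩
  rw [← NNReal.coe_lt_coe]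
  push_cast
  calc (L : ℝ) * (n : ℝ) ^ (1 / p) < (n : ℝ) ^ (1 - 1 / p) * (n : ℝ) ^ (1 / p) := by gcongr
    _ = n := by rw [← Real.rpow_add hn0]; simp

/-- Interpolates from the values `L * n ^ (1 / p)` to real `a`, taking for `n` the integer part of
`(a / L) ^ p`; a vanishing `n` means `a < L`, where monotonicity suffices. Only `n` with `L * n ^ (1
/ p) ≤ a` are used, which keeps small arguments small. -/
theorem growth_of_nat_growth {L : ℝ≥0} (hL : 1 ≤ L) (hp : 0 < p) {a u : ℝ≥0} (ha : 1 ≤ a)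
    (h : ∀ n : ℕ, 0 < n → L * (n : ℝ≥0) ^ (1 / p) ≤ a →
      n * φ u ≤ 2 * φ (L * (n : ℝ≥0) ^ (1 / p) * u)) :
    (4 * L ^ p)⁻¹ * a ^ p * φ u ≤ φ (a * u) := by
  have hL0 : 0 < L := one_pos.trans_le hL
  have hLp : 0 < L ^ p := NNReal.rpow_pos hL0
  rw [mul_assoc, inv_mul_le_iff₀ (by positivity)]
  set n := ⌊(a / L) ^ p⌋₊ with hn
  have hlt : (a / L) ^ p < n + 1 := Nat.lt_floor_add_one _
  rw [NNReal.div_rpow, div_lt_iff₀ hLp] at hlt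
  rcases Nat.eq_zero_or_pos n with h0 | h0
  · rw [h0, Nat.cast_zero, zero_add, one_mul] at hlt
    calc a ^ p * φ u ≤ L ^ p * φ (a * u) := by
          gcongr; exact φ.strictMono.monotone (le_mul_of_one_le_left zero_le ha)
      _ ≤ 4 * L ^ p * φ (a * u) := by
          rw [mul_assoc 4]
          exact le_mul_of_one_le_left zero_le (by norm_num)
  · have h1 : (n : ℝ≥0) ≤ (a / L) ^ p := Nat.floor_le zero_le
    have h2 : L * (n : ℝ≥0) ^ (1 / p) ≤ a := by
      calc L * (n : ℝ≥0) ^ (1 / p) ≤ L * ((a / L) ^ p) ^ (1 / p) := by gcongr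
        _ = L * (a / L) := by
            rw [← NNReal.rpow_mul, mul_one_div_cancel hp.ne', NNReal.rpow_one]
        _ = a := mul_div_cancel₀ _ hL0.ne'
    have h3 : (1 : ℝ≥0) ≤ n := by exact_mod_cast h0
    calc a ^ p * φ u ≤ (n + n) * L ^ p * φ u := by
          gcongr
          exact hlt.le.trans (by gcongr)
      _ = 2 * L ^ p * (n * φ u) := by ring
      _ ≤ 2 * L ^ p * (2 * φ (L * (n : ℝ≥0) ^ (1 / p) * u)) := by exact mul_le_mul_right (h n h0 h2) _
      _ ≤ 2 * L ^ p * (2 * φ (a * u)) := by gcongr; exact φ.strictMono.monotone (by gcongr)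
      _ = _ := by ring

theorem exists_deltas_of_hasRademacherType (hp : 1 < p)
    (h : HasRademacherType (φ.quasiNorm (μ := μ)) p) :
    ∃ (m : ℕ) (L : ℝ≥0), 1 ≤ L ∧
      (∀ u : ℝ≥0, 0 < u → HasDisjointFamily μ (2 ^ m) (1 / φ u) →
        φ (2 * u) ≤ 2 * 2 ^ m * φ u) ∧
      ∀ (n : ℕ) (u : ℝ≥0), 0 < n → 0 < u → HasDisjointFamily μ n (2 / φ u) →
        n * φ u ≤ 2 * φ (L * (n : ℝ≥0) ^ (1 / p) * u) := by
  obtain ⟨K, hK, hT⟩ := h.exists_typeBound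
  have hp0 : 0 < p := by linarith
  obtain ⟨m, hm⟩ := exists_nat_mul_rpow_lt (2 * K) hp
  refine ⟨m, 2 * K + 1, le_add_self, fun u hu hf => hT.doubling_of_hasDisjointFamily hp0 hm hu hf,
    fun n u hn hu hf => (hT.growth_of_hasDisjointFamily hK hp0 hn hu hf).trans ?_⟩
  gcongr
  refine φ.strictMono.monotone ?_
  gcongr
  exact le_self_add

theorem deltas_all_of_hasRademacherType [SigmaFinite μ] (hμ : IsNonatomic μ)
    (htop : μ Set.univ = ∞) (hp : 1 < p) (h : HasRademacherType (φ.quasiNorm (μ := μ)) p) :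
    φ.DeltaTwo .all ∧ φ.DeltaStar p .all := by
  obtain ⟨m, L, hL, h1, h2⟩ := exists_deltas_of_hasRademacherType hp h
  have hL0 : 0 < L := one_pos.trans_le hL
  refine ⟨⟨2 * 2 ^ m, by positivity, fun u => ?_⟩, ⟨(4 * L ^ p)⁻¹, by positivity, fun a u ha => ?_⟩⟩
  · rcases eq_or_ne u 0 with rfl | hu
    · simp [φ.map_zero]
    · exact h1 u hu.bot_lt (hasDisjointFamily_of_measure_univ_eq_top hμ htop _ (by positivity))
  · rcases eq_or_ne u 0 with rfl | hu
    · simp [φ.map_zero]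
    · exact growth_of_nat_growth hL (by linarith) ha fun n hn _ =>
        h2 n u hn hu.bot_lt (hasDisjointFamily_of_measure_univ_eq_top hμ htop _ hn)

theorem deltas_large_of_hasRademacherType [IsFiniteMeasure μ] (hμ : IsNonatomic μ)
    (h0 : μ ≠ 0) (hp : 1 < p) (h : HasRademacherType (φ.quasiNorm (μ := μ)) p) :
    φ.DeltaTwo .large ∧ φ.DeltaStar p .large := by
  obtain ⟨m, L, hL, h1, h2⟩ := exists_deltas_of_hasRademacherType hp h
  have hL0 : 0 < L := one_pos.trans_le hL
  set M := (μ Set.univ).toNNReal with hM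
  have hMμ : (M : ℝ≥0∞) = μ Set.univ := ENNReal.coe_toNNReal (measure_ne_top μ _)
  have hM0 : 0 < M := by
    rw [← ENNReal.coe_pos, hMμ]
    exact (Measure.measure_univ_ne_zero.2 h0).bot_lt
  -- For `u ≥ v` the required total measure `2 / φ u` fits into the whole space.
  obtain ⟨v, hv1, hv2⟩ := ((φ.tendsto_atTop.eventually_ge_atTop (2 / M)).and
    (eventually_gt_atTop 0)).exists
  have hfam : ∀ (u : ℝ≥0) (n : ℕ) (x : ℝ≥0), v ≤ u → 0 < n → x ≤ 2 →
      HasDisjointFamily μ n (x / φ u) := by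
    intro u n x hu hn hx
    refine hμ.hasDisjointFamily MeasurableSet.univ (measure_ne_top μ _) ?_ hn
    rw [← hMμ, ENNReal.coe_le_coe, div_le_iff₀ (φ.pos_of_pos (hv2.trans_le hu))]
    rw [div_le_iff₀ hM0, mul_comm] at hv1
    exact hx.trans (hv1.trans (by gcongr; exact φ.strictMono.monotone hu))
  refine ⟨⟨2 * 2 ^ m, by positivity, v, fun u hu => ?_⟩,
    ⟨(4 * L ^ p)⁻¹, by positivity, v, fun a u ha hu => ?_⟩⟩
  · exact h1 u (hv2.trans_le hu) (hfam u _ 1 hu (by positivity) one_le_two)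
  · exact growth_of_nat_growth hL (by linarith) ha fun n hn _ =>
      h2 n u hn (hv2.trans_le hu) (hfam u n 2 hu hn le_rfl)

theorem exists_pos_le (φ : OrliczFunction) {ε : ℝ≥0} (hε : 0 < ε) : ∃ v : ℝ≥0, 0 < v ∧ φ v ≤ ε := by
  have hlim : Tendsto φ (nhdsWithin 0 (Set.Ioi 0)) (nhds 0) := by
    have := (φ.continuous.tendsto 0).mono_left (nhdsWithin_le_nhds (s := Set.Ioi 0))
    rwa [φ.map_zero] at this
  obtain ⟨v, hv1, hv2⟩ := ((hlim.eventually_le_const hε).and self_mem_nhdsWithin).exists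
  exact ⟨v, hv2, hv1⟩

theorem deltas_small_of_hasRademacherType (hp : 1 < p)
    (h : HasRademacherType (φ.quasiNorm (μ := (Measure.count : Measure ℕ))) p) :
    φ.DeltaTwo .small ∧ φ.DeltaStar p .small := by
  obtain ⟨m, L, hL, h1, h2⟩ := exists_deltas_of_hasRademacherType hp h
  have hL0 : 0 < L := one_pos.trans_le hL
  constructor
  · obtain ⟨v, hv, hφv⟩ := φ.exists_pos_le (ε := (2 ^ m)⁻¹) (by positivity)
    refine ⟨2 * 2 ^ m, by positivity, v, hv, fun u huv => ?_⟩
    rcases eq_or_ne u 0 with rfl | hu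
    · simp [φ.map_zero]
    refine h1 u hu.bot_lt (hasDisjointFamily_count (by positivity) ?_)
    rw [le_div_iff₀ (φ.pos_of_pos hu.bot_lt)]
    push_cast
    calc 2 ^ m * φ u ≤ 2 ^ m * (2 ^ m)⁻¹ := by
          gcongr; exact (φ.strictMono.monotone huv).trans hφv
      _ = 1 := mul_inv_cancel₀ (by positivity)
  · obtain ⟨v, hv, hφv⟩ := φ.exists_pos_le (ε := 1 / 4) (by positivity)
    refine ⟨(4 * L ^ p)⁻¹, by positivity, v, hv, fun a u ha hau => ?_⟩
    rcases eq_or_ne u 0 with rfl | hu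
    · simp [φ.map_zero]
    have hφ := φ.pos_of_pos hu.bot_lt
    have hφu : φ u ≤ 1 / 4 := (φ.strictMono.monotone
      ((le_mul_of_one_le_left zero_le ha).trans hau)).trans hφv
    have hsmall : ∀ n : ℕ, 0 < n → n ≤ 2 / φ u → n * φ u ≤ 2 * φ (L * (n : ℝ≥0) ^ (1 / p) * u) :=
      fun n hn hnu => h2 n u hn hu.bot_lt (hasDisjointFamily_count hn hnu)
    refine growth_of_nat_growth hL (by linarith) ha fun n hn hna => hsmall n hn ?_
    -- Blocks of integers exist only for `n ≤ 2 / φ u`. For larger `n`, the integer part `k` of `2 /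
    -- φ u` is admissible and gives `k * φ u ≤ 2 * φ v ≤ 1/2`, whereas `k * φ u > 2 - φ u ≥ 7/4`.
    by_contra! hlt
    set k := ⌊2 / φ u⌋₊ with hk
    have hk1 : (k : ℝ≥0) ≤ 2 / φ u := Nat.floor_le zero_le
    have hk2 : 2 / φ u < k + 1 := Nat.lt_floor_add_one _
    have hk0 : 0 < k := by
      refine Nat.floor_pos.2 ?_
      rw [one_le_div₀ hφ]
      exact hφu.trans (by rw [← NNReal.coe_le_coe]; push_cast; norm_num)
    have h3 := hsmall k hk0 hk1
    have h4 : φ (L * (k : ℝ≥0) ^ (1 / p) * u) ≤ 1 / 4 := by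
      refine (φ.strictMono.monotone (le_trans ?_ hau)).trans hφv
      gcongr
      refine le_trans ?_ hna
      gcongr
      exact_mod_cast (hk1.trans_lt hlt).le
    rw [div_lt_iff₀ hφ, add_mul, one_mul] at hk2
    rw [← NNReal.coe_lt_coe] at hk2
    rw [← NNReal.coe_le_coe] at h3 h4 hφu
    push_cast at hk2 h3 h4 hφu
    linarith

end OrliczFunction

theorem mainTheorem1 (φ : OrliczFunction) :
    -- non-atomic infinite measure, all arguments
    (∀ {Ω : Type*} [MeasurableSpace Ω] (μ : Measure Ω) [SigmaFinite μ],
      IsNonatomic μ → μ Set.univ = ∞ → 0 < φ.lowerIndex .all →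
        (∀ p : ℝ, 1 < p → p ≤ 2 →
          (HasRademacherType (φ.quasiNorm (μ := μ)) p ↔
            φ.DeltaTwo .all ∧ φ.DeltaStar p .all)) ∧
        (∀ p : ℝ, 0 < p → p ≤ 2 → φ.DeltaTwo .all → φ.DeltaStar p .all →
          HasRademacherType (φ.quasiNorm (μ := μ)) p)) ∧
    -- non-atomic finite nonzero measure, large arguments
    (∀ {Ω : Type*} [MeasurableSpace Ω] (μ : Measure Ω) [IsFiniteMeasure μ],
      IsNonatomic μ → μ ≠ 0 → 0 < φ.lowerIndex .large →
        (∀ p : ℝ, 1 < p → p ≤ 2 →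
          (HasRademacherType (φ.quasiNorm (μ := μ)) p ↔
            φ.DeltaTwo .large ∧ φ.DeltaStar p .large)) ∧
        (∀ p : ℝ, 0 < p → p ≤ 2 → φ.DeltaTwo .large → φ.DeltaStar p .large →
          HasRademacherType (φ.quasiNorm (μ := μ)) p)) ∧
    -- counting measure on the natural numbers, small arguments
    (0 < φ.lowerIndex .small →
        (∀ p : ℝ, 1 < p → p ≤ 2 →
          (HasRademacherType (φ.quasiNorm (μ := (Measure.count : Measure ℕ))) p ↔
            φ.DeltaTwo .small ∧ φ.DeltaStar p .small)) ∧
        (∀ p : ℝ, 0 < p → p ≤ 2 → φ.DeltaTwo .small → φ.DeltaStar p .small →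
          HasRademacherType (φ.quasiNorm (μ := (Measure.count : Measure ℕ))) p)) := by
  refine ⟨fun μ _ hμ htop _ => ⟨fun p hp hp2 => ⟨fun h => ?_, fun h => ?_⟩, fun p hp hp2 hD hs => ?_⟩,
    fun μ _ hμ h0 _ => ⟨fun p hp hp2 => ⟨fun h => ?_, fun h => ?_⟩, fun p hp hp2 hD hs => ?_⟩,
    fun _ => ⟨fun p hp hp2 => ⟨fun h => ?_, fun h => ?_⟩, fun p hp hp2 hD hs => ?_⟩⟩
  · exact OrliczFunction.deltas_all_of_hasRademacherType hμ htop hp h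
  · exact OrliczFunction.hasRademacherType_of_all (by linarith) hp2 h.1 h.2
  · exact OrliczFunction.hasRademacherType_of_all hp hp2 hD hs
  · exact OrliczFunction.deltas_large_of_hasRademacherType hμ h0 hp h
  · exact OrliczFunction.hasRademacherType_of_large (by linarith) hp2 h.1 h.2
  · exact OrliczFunction.hasRademacherType_of_large hp hp2 hD hs
  · exact OrliczFunction.deltas_small_of_hasRademacherType hp h
  · exact OrliczFunction.hasRademacherType_of_small (by linarith) hp2 h.1 h.2
  · exact OrliczFunction.hasRademacherType_of_small hp hp2 hD hs
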